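/- Let $A$ be a commutative ring. A Cayley algebra over $A$ is a unital, not necessarily associative $A$-algebra $E$ with neutral element $e$ and a bijective $A$-linear map $x\mapsto\bar x$ with $\bar e=e$, $\overline{xy}=\bar y\,\bar x$, $x+\bar x\in A\cdot e$ and $x\bar x\in A\cdot e$ for all $x,y\in E$. For $\zeta\in A$, its Cayley–Dickson double using $\zeta$ is the Cayley algebra $E\times E$ with componentwise addition and scalar multiplication, product $(x,y)(x',y')=(xx'-\zeta\cdot(\overline{y'}y),\;y\overline{x'}+y'x)$, neutral element $(e,0)$ and conjugation $\overline{(x,y)}=(\bar x,-y)$. For $n\ge 1$ view $\mathbb Z_n=\mathbb Z/n\mathbb Z$ as a Cayley algebra over itself with the identity as conjugation. For $\alpha,\beta,\gamma\in\mathbb Z_n$ let $\mathbb Z_{n;\alpha}$ be its double using $\alpha$, $\mathbb Z_{n;\alpha,\beta}$ the double of $\mathbb Z_{n;\alpha}$ using $\beta$, and $\mathbb Z_{n;\alpha,\beta,\gamma}$ the double of $\mathbb Z_{n;\alpha,\beta}$ using $\gamma$. For such an algebra $E$ let $E^*$ be the set of elements with a two-sided multiplicative inverse, let $\mathfrak U_E=\{x\in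 E^*: x\bar x=e\}$ be the set of unimodulars, and let $\mathcal A^*$ be the set of invertible elements of the ring $\mathcal A=\mathbb Z_n\cdot e\subseteq E$. **(1) Multiplicativity.** Let $n=\prod_{i=1}^k n_i$ with $n_i\ge1$ pairwise coprime, and let $\alpha,\beta,\gamma\in\mathbb Z_n$ be arbitrary; write $\mathbb Z_{n_i;\alpha}$ etc. for the doubles of $\mathbb Z_{n_i}$ using the reductions of $\alpha,\beta,\gamma$ modulo $n_i$. Then $$\#\mathbb Z_n^*=\prod_i\#\mathbb Z_{n_i}^*,\quad \#\mathbb Z_{n;\alpha}^*=\prod_i\#\mathbb Z_{n_i;\alpha}^*,\quad \#\mathbb Z_{n;\alpha,\beta}^*=\prod_i\#\mathbb Z_{n_i;\alpha,\beta}^*,\quad \#\mathbb Z_{n;\alpha,\beta,\gamma}^*=\prod_i\#\mathbb Z_{n_i;\alpha,\beta,\gamma}^*,$$ and the same four identities hold with $\mathfrak U_E$ in place of $E^*$. **(2) Odd prime powers.** Let $p$ be an odd prime, $s\ge1$, let $\alpha,\beta,\gamma\in\mathbb Z_{p^s}$ be invertible, let $\alpha_0\in\{0,\dots,p-1\}$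 be the residue of $\alpha$ modulo $p$, and let $\left(\frac{\cdot}{p}\right)$ be the Legendre symbol. Then, for each of the four algebras, $\#\mathcal A^*=p^{s-1}(p-1)$, and - $\#\mathbb Z_{p^s}^*=p^{s-1}(p-1)$; - $\#\mathbb Z_{p^s;\alpha}^*=p^{2s}-p^{2(s-1)}\left[p+\left(\frac{\alpha_0}{p}\right)(p-1)(-1)^{\frac{p-1}{2}}\right]$; - $\#\mathbb Z_{p^s;\alpha,\beta}^*=p^{4s}-p^{4(s-1)}\left[p^3+(p-1)p\right]$; - $\#\mathbb Z_{p^s;\alpha,\beta,\gamma}^*=p^{8s}-p^{8(s-1)}\left[p^7+(p-1)p^3\right]$; - $\#\mathfrak U_{\mathbb Z_{p^s}}=2$; - $\#\mathfrak U_{\mathbb Z_{p^s;\alpha}}=p^{s-1}\left[p-\left(\frac{\alpha_0}{p}\right)(-1)^{\frac{p-1}{2}}\right]$; - $\#\mathfrak U_{\mathbb Z_{p^s;\alpha,\beta}}=p^{3(s-1)}\left[p^3-p\right]$; - $\#\mathfrak U_{\mathbb Z_{p^s;\alpha,\beta,\gamma}}=p^{7(s-1)}\left[p^7-p^3\right]$.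 **(3) Powers of two.** Let $s\ge1$, let $\alpha,\beta,\gamma\in\mathbb Z_{2^s}$ be invertible, and let $\alpha_1\in\{0,1\}$ be the coefficient of $2$ in the binary expansion of the representative of $\alpha$ in $\{0,\dots,2^s-1\}$. Then, for each of the four algebras, $\#\mathcal A^*=2^{s-1}$, and - $\#\mathbb Z_{2^s}^*=2^{s-1}$, $\#\mathbb Z_{2^s;\alpha}^*=2^{2s-1}$, $\#\mathbb Z_{2^s;\alpha,\beta}^*=2^{4s-1}$, $\#\mathbb Z_{2^s;\alpha,\beta,\gamma}^*=2^{8s-1}$; - $\#\mathfrak U_{\mathbb Z_{2^s}}$ is $1$ if $s=1$, $2$ if $s=2$, and $4$ if $s\ge3$; - $\#\mathfrak U_{\mathbb Z_{2^s;\alpha}}$ is $2$ if $s=1$, and $2^{s+1-\alpha_1}$ if $s\ge2$; - $\#\mathfrak U_{\mathbb Z_{2^s;\alpha,\beta}}=2^{3s}$ and $\#\mathfrak U_{\mathbb Z_{2^s;\alpha,\beta,\gamma}}=2^{7s}$. -/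

import Mathlib

/-- A conjugation on a unital (not necessarily associative) `A`-algebra `E`, making it a Cayley
algebra over `A`.  That `E` is an `A`-algebra (the product is `A`-bilinear) is expressed by the
instances `IsScalarTower A E E` and `SMulCommClass A E E`. -/
class CayleyAlgebra (A E : Type*) [CommRing A] [NonAssocRing E] [Module A E]
    [IsScalarTower A E E] [SMulCommClass A E E] where
  conj : E →ₗ[A] E
  conj_bijective : Function.Bijective conj
  conj_one : conj 1 = 1
  conj_mul : ∀ x y : E, conj (x * y) = conj y * conj x
  trace_mem : ∀ x : E, ∃ t : A, x + conj x = t • (1 : E)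
  norm_mem : ∀ x : E, ∃ t : A, x * conj x = t • (1 : E)

namespace CayleyAlgebra

/-- A commutative ring as a Cayley algebra over itself, with the identity as conjugation. -/
instance self (A : Type*) [CommRing A] : CayleyAlgebra A A where
  conj := LinearMap.id
  conj_bijective := Function.bijective_id
  conj_one := rfl
  conj_mul x y := mul_comm x y
  trace_mem x := ⟨x + x, by simp⟩
  norm_mem x := ⟨x * x, by simp⟩

section General

set_option linter.unusedSectionVars false

variable (A : Type*) {E : Type*} [CommRing A] [NonAssocRing E] [Module A E]
  [IsScalarTower A E E] [SMulCommClass A E E] [CayleyAlgebra A E]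

theorem conj_conj (x : E) : conj (A := A) (conj (A := A) x) = x := by
  obtain ⟨t, ht⟩ := trace_mem (A := A) x
  have h := congrArg (conj (A := A)) ht
  rw [map_add, map_smul, conj_one, ← ht, add_comm x] at h
  exact add_left_cancel h

theorem conj_mul_self (x : E) : conj (A := A) x * x = x * conj (A := A) x := by
  obtain ⟨t, ht⟩ := trace_mem (A := A) x
  have h : conj (A := A) x = t • (1 : E) - x := by rw [← ht]; abel
  rw [h, sub_mul, mul_sub, smul_mul_assoc, mul_smul_comm, one_mul, mul_one]

/-- The Cayley norm `x * conj x`. -/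
def norm (x : E) : E := x * conj (A := A) x

end General

end CayleyAlgebra

/-- The underlying set of the Cayley-Dickson double of `E` using `ζ`: pairs of elements of `E`. -/
def CayleyDouble (A E : Type*) (_ζ : A) : Type _ := E × E

namespace CayleyDouble

open CayleyAlgebra

set_option linter.unusedSectionVars false

variable {A E : Type*} [CommRing A] [NonAssocRing E] [Module A E] {ζ : A}

instance : AddCommGroup (CayleyDouble A E ζ) := inferInstanceAs (AddCommGroup (E × E))

instance : Module A (CayleyDouble A E ζ) := inferInstanceAs (Module A (E × E))

theorem ext {x y : CayleyDouble A E ζ} (h₁ : x.1 = y.1) (h₂ : x.2 = y.2) : x = y :=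
  Prod.ext h₁ h₂

theorem fst_add (x y : CayleyDouble A E ζ) : (x + y).1 = x.1 + y.1 := rfl
theorem snd_add (x y : CayleyDouble A E ζ) : (x + y).2 = x.2 + y.2 := rfl
theorem fst_zero : (0 : CayleyDouble A E ζ).1 = 0 := rfl
theorem snd_zero : (0 : CayleyDouble A E ζ).2 = 0 := rfl
theorem fst_smul (a : A) (x : CayleyDouble A E ζ) : (a • x).1 = a • x.1 := rfl
theorem snd_smul (a : A) (x : CayleyDouble A E ζ) : (a • x).2 = a • x.2 := rfl

instance : One (CayleyDouble A E ζ) := ⟨((1 : E), (0 : E))⟩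

theorem fst_one : (1 : CayleyDouble A E ζ).1 = 1 := rfl
theorem snd_one : (1 : CayleyDouble A E ζ).2 = 0 := rfl

variable [IsScalarTower A E E] [SMulCommClass A E E] [CayleyAlgebra A E]

/-- `(x, y) * (x', y') = (x x' - ζ • (conj y' * y), y * conj x' + y' * x)`. -/
instance : Mul (CayleyDouble A E ζ) :=
  ⟨fun u v => (u.1 * v.1 - ζ • (conj (A := A) v.2 * u.2), u.2 * conj (A := A) v.1 + v.2 * u.1)⟩

theorem fst_mul (u v : CayleyDouble A E ζ) :
    (u * v).1 = u.1 * v.1 - ζ • (conj (A := A) v.2 * u.2) := rfl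
theorem snd_mul (u v : CayleyDouble A E ζ) :
    (u * v).2 = u.2 * conj (A := A) v.1 + v.2 * u.1 := rfl

instance : NonAssocRing (CayleyDouble A E ζ) where
  left_distrib u v w := by
    apply ext
    · simp only [fst_mul, fst_add, snd_add, map_add, mul_add, add_mul, smul_add]; abel
    · simp only [snd_mul, fst_add, snd_add, map_add, mul_add, add_mul]; abel
  right_distrib u v w := by
    apply ext
    · simp only [fst_mul, fst_add, snd_add, mul_add, add_mul, smul_add]; abel
    · simp only [snd_mul, fst_add, snd_add, mul_add, add_mul]; abel
  zero_mul u := by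
    apply ext
    · simp [fst_mul, fst_zero, snd_zero]
    · simp [snd_mul, fst_zero, snd_zero]
  mul_zero u := by
    apply ext
    · simp [fst_mul, fst_zero, snd_zero]
    · simp [snd_mul, fst_zero, snd_zero]
  one_mul u := by
    apply ext
    · simp [fst_mul, fst_one, snd_one]
    · simp [snd_mul, fst_one, snd_one]
  mul_one u := by
    apply ext
    · simp [fst_mul, fst_one, snd_one]
    · simp [snd_mul, fst_one, snd_one, conj_one]

instance : IsScalarTower A (CayleyDouble A E ζ) (CayleyDouble A E ζ) where
  smul_assoc a u v := by
    simp only [smul_eq_mul]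
    apply ext
    · simp only [fst_mul, fst_smul, snd_smul, smul_sub, smul_mul_assoc, mul_smul_comm]
      rw [smul_comm ζ a]
    · simp only [snd_mul, fst_smul, snd_smul, smul_add, smul_mul_assoc, mul_smul_comm]

instance : SMulCommClass A (CayleyDouble A E ζ) (CayleyDouble A E ζ) where
  smul_comm a u v := by
    simp only [smul_eq_mul]
    apply ext
    · simp only [fst_mul, fst_smul, snd_smul, smul_sub, smul_mul_assoc, mul_smul_comm, map_smul]
      rw [smul_comm ζ a]
    · simp only [snd_mul, fst_smul, snd_smul, smul_add, smul_mul_assoc, mul_smul_comm, map_smul]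

/-- The conjugation `(x, y) ↦ (conj x, -y)` of the double. -/
def conjDouble : CayleyDouble A E ζ →ₗ[A] CayleyDouble A E ζ where
  toFun u := (conj (A := A) u.1, -u.2)
  map_add' u v := by
    apply ext
    · exact map_add (conj (A := A)) u.1 v.1
    · exact neg_add u.2 v.2
  map_smul' a u := by
    apply ext
    · exact map_smul (conj (A := A)) a u.1
    · exact (smul_neg a u.2).symm

theorem fst_conjDouble (u : CayleyDouble A E ζ) : (conjDouble u).1 = conj (A := A) u.1 := rfl
theorem snd_conjDouble (u : CayleyDouble A E ζ) : (conjDouble u).2 = -u.2 := rfl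

instance : CayleyAlgebra A (CayleyDouble A E ζ) where
  conj := conjDouble
  conj_bijective := by
    have h : Function.Involutive (conjDouble : CayleyDouble A E ζ →ₗ[A] CayleyDouble A E ζ) := by
      intro u
      apply ext
      · simp only [fst_conjDouble, conj_conj]
      · simp only [snd_conjDouble, neg_neg]
    exact h.bijective
  conj_one := by
    apply ext
    · simp [fst_conjDouble, fst_one, conj_one]
    · simp [snd_conjDouble, snd_one]
  conj_mul u v := by
    apply ext
    · simp only [fst_conjDouble, fst_mul, snd_conjDouble, map_sub, map_smul, CayleyAlgebra.conj_mul, conj_conj,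
        map_neg, neg_mul_neg]
    · simp only [snd_conjDouble, snd_mul, fst_conjDouble, conj_conj, neg_mul]
      abel
  trace_mem u := by
    obtain ⟨t, ht⟩ := trace_mem (A := A) u.1
    refine ⟨t, ?_⟩
    apply ext
    · simp only [fst_add, fst_conjDouble, fst_smul, fst_one, ht]
    · simp [snd_add, snd_conjDouble, snd_smul, snd_one]
  norm_mem u := by
    obtain ⟨t, ht⟩ := norm_mem (A := A) u.1
    obtain ⟨r, hr⟩ := norm_mem (A := A) u.2
    refine ⟨t + ζ * r, ?_⟩
    apply ext
    · rw [fst_smul, fst_one, add_smul, mul_smul]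
      simp only [fst_mul, fst_conjDouble, snd_conjDouble, ht, map_neg, neg_mul,
        conj_mul_self, hr, smul_neg, sub_neg_eq_add]
    · simp [snd_mul, fst_conjDouble, snd_conjDouble, snd_smul, snd_one, conj_conj]

end CayleyDouble

/-- The set `E*` of elements that have a (two-sided) inverse for the multiplication. -/
def invertibles (E : Type*) [NonAssocRing E] : Set E :=
  {x | ∃ y : E, x * y = 1 ∧ y * x = 1}

/-- The invertible elements of the ring `A · e`, where `e` is the neutral element of `E`. -/
def scalarInvertibles (A E : Type*) [CommRing A] [NonAssocRing E] [Module A E] : Set E :=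
  {x | (∃ a : A, x = a • (1 : E)) ∧
    ∃ y : E, (∃ b : A, y = b • (1 : E)) ∧ x * y = 1 ∧ y * x = 1}

/-- The unimodulars of a Cayley algebra: the invertible elements of Cayley norm `e`. -/
def unimodulars (A E : Type*) [CommRing A] [NonAssocRing E] [Module A E]
    [IsScalarTower A E E] [SMulCommClass A E E] [CayleyAlgebra A E] : Set E :=
  {x | x ∈ invertibles E ∧ CayleyAlgebra.norm A x = 1}

/-- The first double of `ℤ/nℤ`, using `α`. -/
abbrev CayleyInt₁ (n : ℕ) (α : ZMod n) : Type := CayleyDouble (ZMod n) (ZMod n) α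

/-- The second double of `ℤ/nℤ`, using `α` and then `β`. -/
abbrev CayleyInt₂ (n : ℕ) (α β : ZMod n) : Type := CayleyDouble (ZMod n) (CayleyInt₁ n α) β

/-- The third double of `ℤ/nℤ`, using `α`, then `β`, then `γ`. -/
abbrev CayleyInt₃ (n : ℕ) (α β γ : ZMod n) : Type :=
  CayleyDouble (ZMod n) (CayleyInt₂ n α β) γ

/-- The digit of weight `p ^ i` in base `p` of the representative of `x` in `{0, …, n - 1}`. -/
def residueDigit (p : ℕ) {n : ℕ} (x : ZMod n) (i : ℕ) : ℕ := x.val / p ^ i % p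

/-- The reduction `ℤ/(∏ mⱼ)ℤ → ℤ/mᵢℤ`. -/
def residueProj {k : ℕ} (m : Fin k → ℕ) (i : Fin k) : ZMod (∏ j, m j) →+* ZMod (m i) :=
  ZMod.castHom (Finset.dvd_prod_of_mem m (Finset.mem_univ i)) (ZMod (m i))

/-- A multiplicative form `q` on a Cayley algebra such that `x * conj x = q x • 1`
and `conj x * (x * y) = q x • y`. -/
structure IsNormForm {A E : Type*} [CommRing A] [NonAssocRing E] [Module A E]
    [IsScalarTower A E E] [SMulCommClass A E E] [CayleyAlgebra A E] (q : E → A) : Prop where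
  mul_conj : ∀ x : E, x * CayleyAlgebra.conj (A := A) x = q x • (1 : E)
  conj_mul_mul : ∀ x y : E, CayleyAlgebra.conj (A := A) x * (x * y) = q x • y
  map_mul : ∀ x y : E, q (x * y) = q x * q y
  map_one : q 1 = 1
  smul_one_injective : Function.Injective fun a : A => a • (1 : E)

namespace CayleyDouble

open CayleyAlgebra

set_option linter.unusedSectionVars false

variable {A E : Type*} [CommRing A] [NonAssocRing E] [Module A E]
  [IsScalarTower A E E] [SMulCommClass A E E] [CayleyAlgebra A E] {ζ : A}

theorem fst_conj (u : CayleyDouble A E ζ) : (conj (A := A) u).1 = conj (A := A) u.1 := rfl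
theorem snd_conj (u : CayleyDouble A E ζ) : (conj (A := A) u).2 = -u.2 := rfl

theorem fst_sub (x y : CayleyDouble A E ζ) : (x - y).1 = x.1 - y.1 := rfl
theorem snd_sub (x y : CayleyDouble A E ζ) : (x - y).2 = x.2 - y.2 := rfl
theorem fst_neg (x : CayleyDouble A E ζ) : (-x).1 = -x.1 := rfl
theorem snd_neg (x : CayleyDouble A E ζ) : (-x).2 = -x.2 := rfl

end CayleyDouble

theorem CayleyAlgebra.conj_self {A : Type*} [CommRing A] (x : A) :
    CayleyAlgebra.conj (A := A) x = x := rfl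

/-- The form `(x, y) ↦ q x + ζ * q y` on pairs. -/
def doubleForm {A E : Type*} [CommRing A] (ζ : A) (q : E → A) : CayleyDouble A E ζ → A :=
  fun x => q x.1 + ζ * q x.2

theorem doubleForm_apply {A E : Type*} [CommRing A] (ζ : A) (q : E → A)
    (x : CayleyDouble A E ζ) : doubleForm ζ q x = q x.1 + ζ * q x.2 := rfl

/-- The norm form of a commutative ring viewed as a Cayley algebra. -/
def sqForm (A : Type*) [CommRing A] : A → A := fun x => x * x

theorem sqForm_apply {A : Type*} [CommRing A] (x : A) : sqForm A x = x * x := rfl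

section

open CayleyDouble CayleyAlgebra

variable {A : Type*} [CommRing A]

theorem isNormForm_sqForm : IsNormForm (A := A) (sqForm A) where
  mul_conj x := by simp [sqForm_apply, conj_self]
  conj_mul_mul x y := by simp [sqForm_apply, conj_self, mul_assoc]
  map_mul x y := by simp only [sqForm_apply]; ring
  map_one := by simp [sqForm_apply]
  smul_one_injective := fun a b h => by simpa using h

variable {E : Type*} [NonAssocRing E] [Module A E]
  [IsScalarTower A E E] [SMulCommClass A E E] [CayleyAlgebra A E]

theorem IsNormForm.double {q : E → A} (hq : IsNormForm q) (q_zero : q 0 = 0) (ζ : A)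
    (h₁ : ∀ x y : CayleyDouble A E ζ, conj (A := A) x * (x * y) = doubleForm ζ q x • y)
    (h₂ : ∀ x y : CayleyDouble A E ζ,
      doubleForm ζ q (x * y) = doubleForm ζ q x * doubleForm ζ q y) :
    IsNormForm (doubleForm ζ q) where
  mul_conj x := by
    apply CayleyDouble.ext
    · rw [fst_smul, fst_one, doubleForm_apply, add_smul, mul_smul]
      simp only [fst_mul, fst_conj, snd_conj, hq.mul_conj, map_neg, neg_mul,
        conj_mul_self, smul_neg, sub_neg_eq_add]
    · simp [snd_mul, fst_conj, snd_conj, snd_smul, snd_one, conj_conj]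
  conj_mul_mul := h₁
  map_mul := h₂
  map_one := by simp [doubleForm_apply, fst_one, snd_one, hq.map_one, q_zero]
  smul_one_injective a b h := hq.smul_one_injective (congrArg Prod.fst h)

theorem doubleForm_zero {q : E → A} (q_zero : q 0 = 0) (ζ : A) :
    doubleForm ζ q 0 = 0 := by simp [doubleForm_apply, fst_zero, snd_zero, q_zero]

theorem sqForm_zero : sqForm A 0 = 0 := by simp [sqForm_apply]

theorem isNormForm_double₁ (α : A) : IsNormForm (doubleForm α (sqForm A)) := by
  refine isNormForm_sqForm.double sqForm_zero α ?_ ?_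
  · intro x y
    apply CayleyDouble.ext <;>
    · simp only [doubleForm_apply, sqForm_apply, fst_mul, snd_mul, fst_conj, snd_conj, conj_self,
        smul_eq_mul, fst_smul, snd_smul]
      ring
  · intro x y
    simp only [doubleForm_apply, sqForm_apply, fst_mul, snd_mul, conj_self, smul_eq_mul]
    ring

theorem isNormForm_double₂ (α β : A) :
    IsNormForm (doubleForm β (doubleForm α (sqForm A))) := by
  refine (isNormForm_double₁ α).double (doubleForm_zero sqForm_zero α) β ?_ ?_
  · intro x y
    apply CayleyDouble.ext <;> apply CayleyDouble.ext <;>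
    · simp only [doubleForm_apply, sqForm_apply, fst_mul, snd_mul, fst_conj, snd_conj, conj_self,
        smul_eq_mul, fst_smul, snd_smul, fst_sub, snd_sub, fst_add, snd_add, fst_neg, snd_neg]
      ring
  · intro x y
    simp only [doubleForm_apply, sqForm_apply, fst_mul, snd_mul, fst_conj, snd_conj, conj_self,
        smul_eq_mul, fst_smul, snd_smul, fst_sub, snd_sub, fst_add, snd_add]
    ring

theorem isNormForm_double₃ (α β γ : A) :
    IsNormForm (doubleForm γ (doubleForm β (doubleForm α (sqForm A)))) := by
  refine (isNormForm_double₂ α β).double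
    (doubleForm_zero (doubleForm_zero sqForm_zero α) β) γ ?_ ?_
  · intro x y
    apply CayleyDouble.ext <;> apply CayleyDouble.ext <;> apply CayleyDouble.ext <;>
    · simp only [doubleForm_apply, sqForm_apply, fst_mul, snd_mul, fst_conj, snd_conj, conj_self,
        smul_eq_mul, fst_smul, snd_smul, fst_sub, snd_sub, fst_add, snd_add, fst_neg, snd_neg]
      ring
  · intro x y
    simp only [doubleForm_apply, sqForm_apply, fst_mul, snd_mul, fst_conj, snd_conj, conj_self,
        smul_eq_mul, fst_smul, snd_smul, fst_sub, snd_sub, fst_add, snd_add, fst_neg, snd_neg]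
    ring

end

theorem Set.ncard_preimage_eq_mul {X Y : Type*} [Finite X] (f : X → Y) (T : Set Y)
    (hT : T.Finite) (K : ℕ) (h : ∀ y ∈ T, (f ⁻¹' {y}).ncard = K) :
    (f ⁻¹' T).ncard = T.ncard * K := by
  classical
  have := Fintype.ofFinite X
  lift T to Finset Y using hT
  rw [Set.ncard_eq_toFinset_card', Set.ncard_coe_finset,
    Finset.card_eq_sum_card_fiberwise (f := f) (t := T) (fun x hx => by simpa using hx)]
  refine Finset.sum_const_nat fun y hy => ?_
  rw [← h y hy, Set.ncard_eq_toFinset_card']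
  congr 1
  ext x
  simp only [Set.mem_toFinset, Set.mem_preimage, Finset.mem_filter, Finset.mem_coe,
    Set.mem_singleton_iff]
  exact ⟨fun hx => hx.2, fun hx => ⟨hx ▸ hy, hx⟩⟩

theorem Set.ncard_preimage_pi {ι X : Type*} [Fintype ι] {Y : ι → Type*} (f : X → ∀ i, Y i)
    (hf : Function.Bijective f) (S : ∀ i, Set (Y i)) :
    (f ⁻¹' Set.univ.pi S).ncard = ∏ i, (S i).ncard := by
  rw [Set.ncard_preimage_of_injective_subset_range hf.injective
    (by rw [hf.surjective.range_eq]; exact Set.subset_univ _)]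
  simp only [← Nat.card_coe_set_eq]
  rw [Nat.card_congr (Equiv.Set.univPi S), Nat.card_pi]

/-- All fibres of a surjective homomorphism of finite additive groups are equinumerous. -/
theorem AddMonoidHom.ncard_fiber_mul_card {G H : Type*} [AddGroup G] [AddGroup H] [Finite G]
    [Finite H] (f : G →+ H) (hf : Function.Surjective f) (y : H) :
    Nat.card H * (f ⁻¹' {y}).ncard = Nat.card G := by
  have hK : ∀ z : H, (f ⁻¹' {z}).ncard = (f ⁻¹' {y}).ncard := by
    intro z
    obtain ⟨a, rfl⟩ := hf z
    obtain ⟨b, rfl⟩ := hf y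
    refine Set.ncard_congr (fun x _ => x - a + b) ?_ ?_ ?_
    · intro x hx
      simp only [Set.mem_preimage, Set.mem_singleton_iff] at hx ⊢
      simp [hx]
    · intro x x' _ _ h
      simpa using h
    · intro x hx
      simp only [Set.mem_preimage, Set.mem_singleton_iff] at hx
      exact ⟨x - b + a, by simp [hx], by simp⟩
  have h := Set.ncard_preimage_eq_mul f Set.univ Set.finite_univ _ fun z _ => hK z
  rw [Set.preimage_univ, Set.ncard_univ, Set.ncard_univ] at h
  exact h.symm

instance {A E : Type*} [Finite E] (ζ : A) : Finite (CayleyDouble A E ζ) :=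
  inferInstanceAs (Finite (E × E))

namespace IsNormForm

open CayleyAlgebra

variable {A E : Type*} [CommRing A] [NonAssocRing E] [Module A E]
    [IsScalarTower A E E] [SMulCommClass A E E] [CayleyAlgebra A E] {q : E → A}

theorem invertibles_eq (hq : IsNormForm q) : invertibles E = {x | IsUnit (q x)} := by
  ext x
  constructor
  · rintro ⟨y, hy, -⟩
    exact IsUnit.of_mul_eq_one (q y) (by rw [← hq.map_mul, hy, hq.map_one])
  · rintro ⟨u, hu⟩
    refine ⟨(↑u⁻¹ : A) • conj (A := A) x, ?_, ?_⟩
    · rw [mul_smul_comm, hq.mul_conj, ← hu, smul_smul, Units.inv_mul, one_smul]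
    · rw [smul_mul_assoc, conj_mul_self, hq.mul_conj, ← hu, smul_smul, Units.inv_mul, one_smul]

theorem unimodulars_eq (hq : IsNormForm q) : unimodulars A E = {x | q x = 1} := by
  have h : ∀ x : E, CayleyAlgebra.norm A x = 1 ↔ q x = 1 := by
    intro x
    rw [CayleyAlgebra.norm, hq.mul_conj]
    refine ⟨fun h => hq.smul_one_injective (h.trans (one_smul A 1).symm), fun h => ?_⟩
    rw [h, one_smul]
  ext x
  simp only [unimodulars, hq.invertibles_eq, h, Set.mem_ofPred_eq, and_iff_right_iff_imp]
  intro hx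
  rw [hx]
  exact isUnit_one

theorem ncard_scalarInvertibles (hq : IsNormForm q) :
    (scalarInvertibles A E).ncard = {a : A | IsUnit a}.ncard := by
  have hmul : ∀ a b : A, (a • (1 : E)) * (b • 1) = (a * b) • 1 := by
    intro a b
    rw [smul_mul_assoc, one_mul, smul_smul]
  rw [← Set.ncard_image_of_injective {a : A | IsUnit a} hq.smul_one_injective]
  congr 1
  ext x
  constructor
  · rintro ⟨⟨a, rfl⟩, y, ⟨b, rfl⟩, h, -⟩
    rw [hmul] at h
    exact ⟨a, IsUnit.of_mul_eq_one b
      (hq.smul_one_injective (h.trans (one_smul A 1).symm)), rfl⟩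
  · rintro ⟨a, ⟨u, rfl⟩, rfl⟩
    refine ⟨⟨_, rfl⟩, _, ⟨↑u⁻¹, rfl⟩, ?_, ?_⟩
    · rw [hmul, Units.mul_inv, one_smul]
    · rw [hmul, Units.inv_mul, one_smul]

theorem mul_left_injective (hq : IsNormForm q) {x : E} (hx : IsUnit (q x)) :
    Function.Injective fun y => x * y := by
  intro y z h
  have h' := congrArg (fun w => conj (A := A) x * w) h
  simp only [hq.conj_mul_mul] at h'
  exact hx.smul_left_cancel.mp h'

theorem ncard_fiber (hq : IsNormForm q) [Finite E] {x : E} (hx : IsUnit (q x)) :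
    (q ⁻¹' {q x}).ncard = {y | q y = 1}.ncard := by
  have hb : Function.Bijective fun y => x * y :=
    Finite.injective_iff_bijective.mp (hq.mul_left_injective hx)
  have h : {y | q y = 1} = (fun y => x * y) ⁻¹' (q ⁻¹' {q x}) := by
    ext y
    simp only [Set.mem_ofPred_eq, Set.mem_preimage, Set.mem_singleton_iff, hq.map_mul]
    exact ⟨fun h => by rw [h, mul_one], fun h => hx.mul_left_cancel (by rw [h, mul_one])⟩
  rw [h, Set.ncard_preimage_of_injective_subset_range hb.injective
    (by rw [hb.surjective.range_eq]; exact Set.subset_univ _)]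

theorem ncard_isUnit (hq : IsNormForm q) [Finite E] [Finite A] :
    {x | IsUnit (q x)}.ncard =
      {u | IsUnit u ∧ ∃ x, q x = u}.ncard * {x | q x = 1}.ncard := by
  rw [← Set.ncard_preimage_eq_mul q _ (Set.toFinite _)]
  · congr 1
    ext x
    simp
  · rintro _ ⟨hu, x, rfl⟩
    exact hq.ncard_fiber hu

end IsNormForm

section Residues

variable {ι A E : Type*} {B F : ι → Type*} [CommRing A] [∀ i, CommRing (B i)]

/-- The double of a bijective family of maps is bijective. -/
theorem bijective_double {f : ∀ i, E → F i} (hf : Function.Bijective fun x i => f i x) (ζ : A)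
    (r : ∀ i, A →+* B i) :
    Function.Bijective fun (x : CayleyDouble A E ζ) i =>
      ((f i x.1, f i x.2) : CayleyDouble (B i) (F i) (r i ζ)) := by
  constructor
  · intro x y h
    exact Prod.ext (hf.injective (funext fun i => congrArg Prod.fst (congrFun h i)))
      (hf.injective (funext fun i => congrArg Prod.snd (congrFun h i)))
  · intro y
    obtain ⟨a, ha⟩ := hf.surjective fun i => (y i).1
    obtain ⟨b, hb⟩ := hf.surjective fun i => (y i).2
    exact ⟨(a, b), funext fun i => Prod.ext (congrFun ha i) (congrFun hb i)⟩

theorem doubleForm_map {F₀ B₀ : Type*} [CommRing B₀] (r : A →+* B₀) {f : E → F₀} {q : E → A}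
    {q' : F₀ → B₀} (hq : ∀ x, q' (f x) = r (q x)) (ζ : A) (x : CayleyDouble A E ζ) :
    doubleForm (r ζ) q' (f x.1, f x.2) = r (doubleForm ζ q x) := by
  simp only [doubleForm_apply, map_add, map_mul, ← hq]
  rfl

theorem sqForm_map {B₀ : Type*} [CommRing B₀] (r : A →+* B₀) (x : A) :
    sqForm B₀ (r x) = r (sqForm A x) := by
  simp only [sqForm_apply, map_mul]

theorem isUnit_iff_of_bijective (r : ∀ i, A →+* B i) (hr : Function.Bijective fun x i => r i x)
    (a : A) : IsUnit a ↔ ∀ i, IsUnit (r i a) := by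
  refine ⟨fun h i => h.map (r i), fun h => ?_⟩
  choose b hb using fun i => (h i).exists_right_inv
  obtain ⟨c, hc⟩ := hr.surjective b
  refine IsUnit.of_mul_eq_one c (hr.injective (funext fun i => ?_))
  have := congrFun hc i
  simp only [map_mul, map_one] at this ⊢
  rw [this, hb]

variable [Fintype ι] (r : ∀ i, A →+* B i) (hr : Function.Bijective fun x i => r i x)
  (f : ∀ i, E → F i) (hf : Function.Bijective fun x i => f i x) {q : E → A}
  {q' : ∀ i, F i → B i} (hq : ∀ i x, q' i (f i x) = r i (q x))

include hr hf hq

theorem ncard_isUnit_eq_prod :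
    {x | IsUnit (q x)}.ncard = ∏ i, {x | IsUnit (q' i x)}.ncard := by
  rw [← Set.ncard_preimage_pi _ hf]
  congr 1
  ext x
  simp [Set.mem_pi, isUnit_iff_of_bijective r hr, hq]

theorem ncard_eq_one_eq_prod :
    {x | q x = 1}.ncard = ∏ i, {x | q' i x = 1}.ncard := by
  rw [← Set.ncard_preimage_pi _ hf]
  congr 1
  ext x
  simp only [Set.mem_ofPred_eq, Set.mem_preimage, Set.mem_pi, Set.mem_univ, forall_const, hq]
  exact ⟨fun h i => by rw [h, map_one],
    fun h => hr.injective (funext fun i => by simp [h i])⟩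

end Residues

theorem invertibles_eq_isUnit (A : Type*) [CommRing A] : invertibles A = {x | IsUnit x} := by
  ext x
  exact ⟨fun ⟨y, hy, _⟩ => IsUnit.of_mul_eq_one y hy,
    fun ⟨u, hu⟩ => ⟨↑u⁻¹, by rw [← hu, Units.mul_inv], by rw [← hu, Units.inv_mul]⟩⟩

theorem multiplicativity (k : ℕ) (m : Fin k → ℕ)
    (hm : ∀ i j, i ≠ j → Nat.Coprime (m i) (m j)) (α β γ : ZMod (∏ i, m i)) :
    (invertibles (ZMod (∏ i, m i))).ncard = ∏ i, (invertibles (ZMod (m i))).ncard ∧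
    (invertibles (CayleyInt₁ (∏ i, m i) α)).ncard =
      ∏ i, (invertibles (CayleyInt₁ (m i) (residueProj m i α))).ncard ∧
    (invertibles (CayleyInt₂ (∏ i, m i) α β)).ncard =
      ∏ i, (invertibles
        (CayleyInt₂ (m i) (residueProj m i α) (residueProj m i β))).ncard ∧
    (invertibles (CayleyInt₃ (∏ i, m i) α β γ)).ncard =
      ∏ i, (invertibles (CayleyInt₃ (m i)
        (residueProj m i α) (residueProj m i β) (residueProj m i γ))).ncard ∧
    (unimodulars (ZMod (∏ i, m i)) (ZMod (∏ i, m i))).ncard =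
      ∏ i, (unimodulars (ZMod (m i)) (ZMod (m i))).ncard ∧
    (unimodulars (ZMod (∏ i, m i)) (CayleyInt₁ (∏ i, m i) α)).ncard =
      ∏ i, (unimodulars (ZMod (m i)) (CayleyInt₁ (m i) (residueProj m i α))).ncard ∧
    (unimodulars (ZMod (∏ i, m i)) (CayleyInt₂ (∏ i, m i) α β)).ncard =
      ∏ i, (unimodulars (ZMod (m i))
        (CayleyInt₂ (m i) (residueProj m i α) (residueProj m i β))).ncard ∧
    (unimodulars (ZMod (∏ i, m i)) (CayleyInt₃ (∏ i, m i) α β γ)).ncard =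
      ∏ i, (unimodulars (ZMod (m i)) (CayleyInt₃ (m i)
        (residueProj m i α) (residueProj m i β) (residueProj m i γ))).ncard := by
  have hc : Pairwise (Function.onFun Nat.Coprime m) := fun i j hij => hm i j hij
  have hr : Function.Bijective fun (x : ZMod (∏ i, m i)) i => residueProj m i x := by
    have h : (fun (x : ZMod (∏ i, m i)) i => residueProj m i x) =
        ZMod.prodEquivPi m hc := by
      ext x i
      rw [ZMod.prodEquivPi_apply]
      rfl
    rw [h]
    exact RingEquiv.bijective _
  have b₁ := bijective_double hr α (residueProj m)
  have b₂ := bijective_double b₁ β (residueProj m)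
  have b₃ := bijective_double b₂ γ (residueProj m)
  have c₀ := fun i => sqForm_map (residueProj m i)
  have c₁ := fun i => doubleForm_map (residueProj m i) (c₀ i) α
  have c₂ := fun i => doubleForm_map (residueProj m i) (c₁ i) β
  have c₃ := fun i => doubleForm_map (residueProj m i) (c₂ i) γ
  simp only [isNormForm_sqForm.unimodulars_eq, (isNormForm_double₁ _).unimodulars_eq,
    (isNormForm_double₂ _ _).unimodulars_eq, (isNormForm_double₃ _ _ _).unimodulars_eq,
    invertibles_eq_isUnit, (isNormForm_double₁ _).invertibles_eq,
    (isNormForm_double₂ _ _).invertibles_eq, (isNormForm_double₃ _ _ _).invertibles_eq]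
  exact ⟨ncard_isUnit_eq_prod (residueProj m) hr (q := id) (q' := fun _ => id) _ hr
      fun _ _ => rfl,
    ncard_isUnit_eq_prod (residueProj m) hr _ b₁ c₁,
    ncard_isUnit_eq_prod (residueProj m) hr _ b₂ c₂,
    ncard_isUnit_eq_prod (residueProj m) hr _ b₃ c₃,
    ncard_eq_one_eq_prod (residueProj m) hr _ hr c₀,
    ncard_eq_one_eq_prod (residueProj m) hr _ b₁ c₁,
    ncard_eq_one_eq_prod (residueProj m) hr _ b₂ c₂,
    ncard_eq_one_eq_prod (residueProj m) hr _ b₃ c₃⟩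

theorem nat_card_double {A E : Type*} (ζ : A) :
    Nat.card (CayleyDouble A E ζ) = Nat.card E ^ 2 := by
  rw [sq]
  exact Nat.card_prod E E

theorem ncard_fiber_prod {E F : Type*} (f : E → F) (y z : F) :
    ((fun x : E × E => (f x.1, f x.2)) ⁻¹' {(y, z)}).ncard =
      (f ⁻¹' {y}).ncard * (f ⁻¹' {z}).ncard := by
  rw [← Set.ncard_prod]
  congr 1
  ext x
  exact Prod.ext_iff

theorem ncard_fiber_double {A E B F : Type*} {f : E → F} {K : ℕ}
    (hf : ∀ y, (f ⁻¹' {y}).ncard = K) (ζ : A) (ζ' : B) (y : CayleyDouble B F ζ') :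
    ((fun x : CayleyDouble A E ζ => ((f x.1, f x.2) : CayleyDouble B F ζ')) ⁻¹' {y}).ncard =
      K ^ 2 := by
  refine (ncard_fiber_prod f y.1 y.2).trans ?_
  rw [hf, hf, sq]

theorem ncard_isUnit_eq_mul {A E F B : Type*} [CommRing A] [Field B] [Finite E] [Finite F]
    {r : A →+* B} (hr : ∀ a, IsUnit a ↔ r a ≠ 0) {f : E → F} {K : ℕ}
    (hf : ∀ y, (f ⁻¹' {y}).ncard = K) {q : E → A} {q' : F → B} (hq : ∀ x, q' (f x) = r (q x)) :
    {x | IsUnit (q x)}.ncard = {y | q' y ≠ 0}.ncard * K := by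
  rw [← Set.ncard_preimage_eq_mul f {y | q' y ≠ 0} (Set.toFinite _) K fun y _ => hf y]
  congr 1
  ext x
  simp [hr, hq]

theorem exists_double_eq {A E : Type*} [CommRing A] [Zero E] {q : E → A} (q_zero : q 0 = 0)
    (h : ∀ u : A, IsUnit u → ∃ x, q x = u) (ζ : A) (u : A) (hu : IsUnit u) :
    ∃ x, doubleForm ζ q x = u := by
  obtain ⟨x, hx⟩ := h u hu
  exact ⟨(x, 0), by simp [doubleForm, hx, q_zero]⟩

section Field

variable {F E : Type*} [Field F] [Finite F]

theorem ncard_ne_zero : {u : F | u ≠ 0}.ncard = Nat.card F - 1 := by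
  have h : {u : F | u ≠ 0} = ({0} : Set F)ᶜ := rfl
  rw [h, Set.ncard_compl, Set.ncard_singleton]

variable [Finite E] {q : E → F} {C : ℕ}

theorem ncard_form_ne_zero (hC : ∀ u : F, u ≠ 0 → (q ⁻¹' {u}).ncard = C) :
    {x | q x ≠ 0}.ncard = (Nat.card F - 1) * C := by
  rw [← ncard_ne_zero]
  exact Set.ncard_preimage_eq_mul q {u | u ≠ 0} (Set.toFinite _) C hC

theorem ncard_form_zero_add (hC : ∀ u : F, u ≠ 0 → (q ⁻¹' {u}).ncard = C) :
    {x | q x = 0}.ncard + (Nat.card F - 1) * C = Nat.card E := by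
  rw [← ncard_form_ne_zero hC, ← Set.ncard_add_ncard_compl {x | q x = 0}]
  rfl

theorem ncard_doubleForm_zero (hC : ∀ u : F, u ≠ 0 → (q ⁻¹' {u}).ncard = C) {ζ : F}
    (hζ : ζ ≠ 0) :
    {x | doubleForm ζ q x = 0}.ncard =
      {x | q x = 0}.ncard ^ 2 + (Nat.card F - 1) * C ^ 2 := by
  let T : Set (F × F) := (fun u => (-(ζ * u), u)) '' {u | u ≠ 0}
  let g : E × E → F × F := fun x => (q x.1, q x.2)
  have hT : T.ncard = Nat.card F - 1 := by
    rw [← ncard_ne_zero]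
    exact Set.ncard_image_of_injective _ fun u v h => congrArg Prod.snd h
  have hB : (g ⁻¹' T).ncard = (Nat.card F - 1) * C ^ 2 := by
    rw [← hT]
    refine Set.ncard_preimage_eq_mul g T (Set.toFinite _) _ ?_
    rintro _ ⟨u, hu, rfl⟩
    rw [ncard_fiber_prod, hC u hu, hC _ (neg_ne_zero.mpr (mul_ne_zero hζ hu)), sq]
  have hsplit : {x : E × E | q x.1 + ζ * q x.2 = 0} = ({x | q x = 0} ×ˢ {x | q x = 0}) ∪ g ⁻¹' T := by
    ext x
    simp only [Set.mem_ofPred_eq, Set.mem_union, Set.mem_prod, Set.mem_preimage]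
    constructor
    · intro h
      by_cases h2 : q x.2 = 0
      · left
        rw [h2, mul_zero, add_zero] at h
        exact ⟨h, h2⟩
      · exact Or.inr ⟨q x.2, h2, Prod.ext (eq_neg_of_add_eq_zero_left h).symm rfl⟩
    · rintro (⟨h1, h2⟩ | ⟨u, hu, h⟩)
      · rw [h1, h2, mul_zero, add_zero]
      · have h1 : -(ζ * u) = q x.1 := congrArg Prod.fst h
        have h2 : u = q x.2 := congrArg Prod.snd h
        rw [← h1, ← h2, neg_add_cancel]
  have hdisj : Disjoint ({x | q x = 0} ×ˢ {x | q x = 0}) (g ⁻¹' T) := by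
    rw [Set.disjoint_left]
    rintro x ⟨-, h2⟩ ⟨u, hu, h⟩
    have h3 : u = q x.2 := congrArg Prod.snd h
    exact hu (h3.trans h2)
  change {x : E × E | q x.1 + ζ * q x.2 = 0}.ncard = _
  rw [hsplit, Set.ncard_union_eq hdisj (Set.toFinite _) (Set.toFinite _), Set.ncard_prod, hB, ← sq]

end Field

section PrimePower

variable {p s : ℕ} [Fact p.Prime]

theorem isUnit_iff_castHom_ne_zero (hs : p ∣ p ^ s) (a : ZMod (p ^ s)) :
    IsUnit a ↔ ZMod.castHom hs (ZMod p) a ≠ 0 := by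
  have : NeZero (p ^ s) := ⟨pow_ne_zero s (Fact.out : p.Prime).ne_zero⟩
  have hs0 : s ≠ 0 := by
    rintro rfl
    exact (Fact.out : p.Prime).one_lt.ne' (Nat.dvd_one.mp (by simpa using hs))
  rw [← ZMod.natCast_zmod_val a, map_natCast, ZMod.isUnit_iff_coprime, Ne,
    ZMod.natCast_eq_zero_iff, Nat.coprime_pow_right_iff (Nat.pos_of_ne_zero hs0),
    Nat.coprime_comm, (Fact.out : p.Prime).coprime_iff_not_dvd]

theorem ncard_fiber_castHom {t : ℕ} (hts : t ≤ s) (y : ZMod (p ^ t)) :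
    (ZMod.castHom (pow_dvd_pow p hts) (ZMod (p ^ t)) ⁻¹' {y}).ncard = p ^ (s - t) := by
  have hp : 0 < p := (Fact.out : p.Prime).pos
  have (k : ℕ) : NeZero (p ^ k) := ⟨(pow_pos hp k).ne'⟩
  have h := AddMonoidHom.ncard_fiber_mul_card
    (ZMod.castHom (pow_dvd_pow p hts) (ZMod (p ^ t))).toAddMonoidHom
    (ZMod.castHom_surjective (pow_dvd_pow p hts)) y
  rw [Nat.card_zmod, Nat.card_zmod] at h
  refine Nat.eq_of_mul_eq_mul_left (pow_pos hp t) (h.trans ?_)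
  rw [← pow_add, Nat.add_sub_cancel' hts]

theorem ncard_fiber_castHom_prime {s : ℕ} (hs : p ∣ p ^ s) (y : ZMod p) :
    (ZMod.castHom hs (ZMod p) ⁻¹' {y}).ncard = p ^ (s - 1) := by
  have hp : 0 < p := (Fact.out : p.Prime).pos
  have (k : ℕ) : NeZero (p ^ k) := ⟨(pow_pos hp k).ne'⟩
  have : NeZero p := ⟨hp.ne'⟩
  have hs0 : s ≠ 0 := by
    rintro rfl
    exact (Fact.out : p.Prime).one_lt.ne' (Nat.dvd_one.mp (by simpa using hs))
  have h := AddMonoidHom.ncard_fiber_mul_card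
    (ZMod.castHom hs (ZMod p)).toAddMonoidHom (ZMod.castHom_surjective hs) y
  rw [Nat.card_zmod, Nat.card_zmod] at h
  refine Nat.eq_of_mul_eq_mul_left hp (h.trans ?_)
  rw [mul_comm, ← pow_succ, Nat.sub_add_cancel (Nat.one_le_iff_ne_zero.mpr hs0)]

theorem ncard_isUnit_prime_pow (hs : p ∣ p ^ s) :
    {a : ZMod (p ^ s) | IsUnit a}.ncard = p ^ (s - 1) * (p - 1) := by
  have : NeZero (p ^ s) := ⟨pow_ne_zero s (Fact.out : p.Prime).ne_zero⟩
  have h := ncard_isUnit_eq_mul (isUnit_iff_castHom_ne_zero hs) (ncard_fiber_castHom_prime hs)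
    (q := id) (q' := id) fun _ => rfl
  simp only [id] at h
  rw [h, ncard_ne_zero, Nat.card_zmod, mul_comm]

theorem ncard_isUnit_double₁ (hs : p ∣ p ^ s) (α : ZMod (p ^ s)) :
    {x | IsUnit (doubleForm α (sqForm (ZMod (p ^ s))) x)}.ncard =
      {x | doubleForm (ZMod.castHom hs (ZMod p) α) (sqForm (ZMod p)) x ≠ 0}.ncard *
        (p ^ (s - 1)) ^ 2 := by
  have : NeZero (p ^ s) := ⟨pow_ne_zero s (Fact.out : p.Prime).ne_zero⟩
  exact ncard_isUnit_eq_mul (isUnit_iff_castHom_ne_zero hs)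
    (ncard_fiber_double (ncard_fiber_castHom_prime hs) _ _)
    (doubleForm_map _ (sqForm_map _) α)

theorem ncard_isUnit_double₂ (hs : p ∣ p ^ s) (α β : ZMod (p ^ s)) :
    {x | IsUnit (doubleForm β (doubleForm α (sqForm (ZMod (p ^ s)))) x)}.ncard =
      {x | doubleForm (ZMod.castHom hs (ZMod p) β)
        (doubleForm (ZMod.castHom hs (ZMod p) α) (sqForm (ZMod p))) x ≠ 0}.ncard *
        (p ^ (s - 1)) ^ 4 := by
  have : NeZero (p ^ s) := ⟨pow_ne_zero s (Fact.out : p.Prime).ne_zero⟩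
  rw [show (p ^ (s - 1)) ^ 4 = ((p ^ (s - 1)) ^ 2) ^ 2 by ring]
  exact ncard_isUnit_eq_mul (isUnit_iff_castHom_ne_zero hs)
    (ncard_fiber_double (ncard_fiber_double (ncard_fiber_castHom_prime hs) _ _) _ _)
    (doubleForm_map _ (doubleForm_map _ (sqForm_map _) α) β)

theorem ncard_isUnit_double₃ (hs : p ∣ p ^ s) (α β γ : ZMod (p ^ s)) :
    {x | IsUnit (doubleForm γ (doubleForm β (doubleForm α (sqForm (ZMod (p ^ s))))) x)}.ncard =
      {x | doubleForm (ZMod.castHom hs (ZMod p) γ) (doubleForm (ZMod.castHom hs (ZMod p) β)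
        (doubleForm (ZMod.castHom hs (ZMod p) α) (sqForm (ZMod p)))) x ≠ 0}.ncard *
        (p ^ (s - 1)) ^ 8 := by
  have : NeZero (p ^ s) := ⟨pow_ne_zero s (Fact.out : p.Prime).ne_zero⟩
  rw [show (p ^ (s - 1)) ^ 8 = (((p ^ (s - 1)) ^ 2) ^ 2) ^ 2 by ring]
  exact ncard_isUnit_eq_mul (isUnit_iff_castHom_ne_zero hs)
    (ncard_fiber_double (ncard_fiber_double (ncard_fiber_double (ncard_fiber_castHom_prime hs)
      _ _) _ _) _ _)
    (doubleForm_map _ (doubleForm_map _ (doubleForm_map _ (sqForm_map _) α) β) γ)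

end PrimePower

/-- If the form takes every unit value, the invertible elements are equidistributed over the
units. -/
theorem IsNormForm.ncard_isUnit_of_surjective {A E : Type*} [CommRing A] [NonAssocRing E]
    [Module A E] [IsScalarTower A E E] [SMulCommClass A E E] [CayleyAlgebra A E] {q : E → A}
    (hq : IsNormForm q) [Finite E] [Finite A] (h : ∀ u : A, IsUnit u → ∃ x, q x = u) :
    {x | IsUnit (q x)}.ncard = {u : A | IsUnit u}.ncard * {x | q x = 1}.ncard := by
  rw [hq.ncard_isUnit]
  congr 2
  ext u
  exact ⟨fun hu => hu.1, fun hu => ⟨hu, h u hu⟩⟩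

theorem IsNormForm.ncard_fiber_of_surjective {F E : Type*} [Field F] [NonAssocRing E]
    [Module F E] [IsScalarTower F E E] [SMulCommClass F E E] [CayleyAlgebra F E] {q : E → F}
    (hq : IsNormForm q) [Finite E] (h : ∀ u : F, IsUnit u → ∃ x, q x = u) (u : F)
    (hu : u ≠ 0) : (q ⁻¹' {u}).ncard = {x | q x = 1}.ncard := by
  obtain ⟨x, rfl⟩ := h u hu.isUnit
  exact hq.ncard_fiber hu.isUnit

/-- An element of `ℤ/p^s` that is congruent to `1` modulo the odd prime `p` is a square. -/
theorem isSquare_of_castHom_eq_one {p s : ℕ} [Fact p.Prime] (hp : p ≠ 2) (hs : p ∣ p ^ s)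
    (v : ZMod (p ^ s)) (hv : ZMod.castHom hs (ZMod p) v = 1) : IsSquare v := by
  have : NeZero (p ^ s) := ⟨pow_ne_zero s (Fact.out : p.Prime).ne_zero⟩
  have hd : (p : ℤ) ∣ (v.val : ℤ) - 1 := by
    rw [← ZMod.intCast_zmod_eq_zero_iff_dvd]
    rw [← ZMod.natCast_zmod_val v, map_natCast] at hv
    push_cast
    rw [hv, sub_self]
  have h := dvd_sub_pow_of_dvd_sub hd s
  have hv1 : v ^ p ^ s = 1 := by
    have h' : ((p ^ s : ℕ) : ℤ) ∣ (v.val : ℤ) ^ p ^ s - 1 ^ p ^ s :=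
      (Dvd.intro _ (by push_cast; rw [pow_succ])).trans h
    rw [← ZMod.intCast_zmod_eq_zero_iff_dvd] at h'
    push_cast at h'
    rw [ZMod.natCast_zmod_val, one_pow] at h'
    exact sub_eq_zero.mp h'
  obtain ⟨m, hm⟩ := ((Fact.out : p.Prime).odd_of_ne_two hp).pow (n := s)
  refine ⟨v ^ (m + 1), ?_⟩
  rw [← pow_add, show m + 1 + (m + 1) = (2 * m + 1) + 1 by ring, ← hm, pow_succ, hv1, one_mul]

/-- Over a finite field of odd characteristic, `x ^ 2 + a * y ^ 2` takes every value. -/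
theorem exists_sq_add_mul_sq {F : Type*} [Field F] [Finite F] (hF : ringChar F ≠ 2) {a : F}
    (ha : a ≠ 0) (u : F) : ∃ x y : F, x * x + a * (y * y) = u := by
  classical
  have := Fintype.ofFinite F
  open Polynomial in
  obtain ⟨x, y, h⟩ := FiniteField.exists_root_sum_quadratic (R := F) (f := X ^ 2)
    (g := C a * X ^ 2 + C 0 * X + C (-u)) (degree_X_pow 2) (degree_quadratic ha)
    (FiniteField.odd_card_of_char_ne_two hF)
  refine ⟨x, y, ?_⟩
  simp only [Polynomial.eval_pow, Polynomial.eval_X, Polynomial.eval_add, Polynomial.eval_mul,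
    Polynomial.eval_C] at h
  linear_combination h

theorem ncard_sq_add_mul_sq_of_not_isSquare {F : Type*} [Field F] {a : F}
    (h : ¬ IsSquare (-a)) : {x | doubleForm a (sqForm F) x = 0}.ncard = 1 := by
  rw [Set.ncard_eq_one]
  refine ⟨0, Set.eq_singleton_iff_unique_mem.mpr ⟨doubleForm_zero sqForm_zero a, ?_⟩⟩
  intro x hx
  have hx' : x.1 * x.1 + a * (x.2 * x.2) = 0 := hx
  have h2 : x.2 = 0 := by
    by_contra h2
    refine h ⟨x.1 / x.2, ?_⟩
    field_simp
    linear_combination -hx'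
  rw [h2] at hx'
  have h1 : x.1 = 0 := by simpa using hx'
  exact CayleyDouble.ext h1 h2

theorem ncard_sq_add_mul_sq_of_isSquare {F : Type*} [Field F] [Finite F] (h2 : (2 : F) ≠ 0)
    {a : F} (ha : a ≠ 0) (h : IsSquare (-a)) :
    {x | doubleForm a (sqForm F) x = 0}.ncard + 1 = 2 * Nat.card F := by
  obtain ⟨c, hc⟩ := h
  have hc0 : c ≠ 0 := by
    rintro rfl
    exact ha (by simpa using hc)
  let S : F → Set (F × F) := fun d => Set.range fun y => (d * y, y)
  have hS : ∀ d, (S d).ncard = Nat.card F := by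
    intro d
    rw [← Set.ncard_univ, ← Set.ncard_image_of_injective (f := fun y : F => (d * y, y)) Set.univ
      fun y z h => congrArg Prod.snd h, Set.image_univ]
  have hU : {x : F × F | x.1 * x.1 + a * (x.2 * x.2) = 0} = S c ∪ S (-c) := by
    ext ⟨x, y⟩
    simp only [Set.mem_ofPred_eq, Set.mem_union, S, Set.mem_range, Prod.mk.injEq]
    constructor
    · intro h
      have : (c * y - x) * (-c * y - x) = 0 := by linear_combination h + y * y * hc
      rcases mul_eq_zero.mp this with h | h
      · exact Or.inl ⟨y, sub_eq_zero.mp h, rfl⟩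
      · exact Or.inr ⟨y, sub_eq_zero.mp h, rfl⟩
    · rintro (⟨z, rfl, rfl⟩ | ⟨z, rfl, rfl⟩) <;> linear_combination -z * z * hc
  have hI : S c ∩ S (-c) = {0} := by
    ext ⟨x, y⟩
    simp only [Set.mem_inter_iff, S, Set.mem_range, Prod.mk.injEq, Set.mem_singleton_iff,
      Prod.mk_eq_zero]
    constructor
    · rintro ⟨⟨z, hz, rfl⟩, ⟨w, hw, rfl⟩⟩
      have : 2 * c * w = 0 := by linear_combination hz - hw
      have hw0 : w = 0 := by simpa [h2, hc0] using this
      exact ⟨by rw [← hz, hw0, mul_zero], hw0⟩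
    · rintro ⟨rfl, rfl⟩
      exact ⟨⟨0, by simp⟩, ⟨0, by simp⟩⟩
  have := Set.ncard_union_add_ncard_inter (S c) (S (-c))
  rw [hI, Set.ncard_singleton, hS, hS, ← hU, ← two_mul] at this
  exact this

theorem ncard_sq_add_mul_sq {p : ℕ} [Fact p.Prime] (hp : p ≠ 2) (d : ℕ)
    (hd : (d : ZMod p) ≠ 0) :
    ({x | doubleForm (d : ZMod p) (sqForm (ZMod p)) x = 0}.ncard : ℤ) =
      p + legendreSym p d * (p - 1) * (-1) ^ ((p - 1) / 2) := by
  have hodd : p % 2 = 1 := Nat.odd_iff.mp ((Fact.out : p.Prime).odd_of_ne_two hp)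
  have h1 : legendreSym p d * (-1) ^ ((p - 1) / 2) = legendreSym p (-d) := by
    rw [legendreSym.at_neg hp, ZMod.χ₄_eq_neg_one_pow hodd,
      show (p - 1) / 2 = p / 2 by omega, mul_comm]
  have h2 : (2 : ZMod p) ≠ 0 := Ring.two_ne_zero (by rwa [ZMod.ringChar_zmod_n])
  have hcast : ((-(d : ℤ) : ℤ) : ZMod p) = -(d : ZMod p) := by push_cast; rfl
  have h0 : ((-(d : ℤ) : ℤ) : ZMod p) ≠ 0 := by rw [hcast]; exact neg_ne_zero.mpr hd
  rw [mul_right_comm, h1]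
  by_cases h : IsSquare (-(d : ZMod p))
  · have h3 := ncard_sq_add_mul_sq_of_isSquare h2 hd h
    rw [Nat.card_zmod] at h3
    rw [(legendreSym.eq_one_iff p h0).mpr (by rwa [hcast])]
    linarith
  · rw [ncard_sq_add_mul_sq_of_not_isSquare h, (legendreSym.eq_neg_one_iff p).mpr (by rwa [hcast])]
    push_cast
    ring

theorem ncard_mul_self_eq_one {p s : ℕ} [Fact p.Prime] (hp : p ≠ 2) (hs : p ∣ p ^ s) :
    {x | sqForm (ZMod (p ^ s)) x = 1}.ncard = 2 := by
  have h2 : (2 : ZMod p) ≠ 0 := Ring.two_ne_zero (by rwa [ZMod.ringChar_zmod_n])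
  let r := ZMod.castHom hs (ZMod p)
  have hne : (1 : ZMod (p ^ s)) ≠ -1 := by
    intro h
    have h' := congrArg r h
    rw [map_neg, map_one] at h'
    exact h2 (by linear_combination h')
  rw [← Set.ncard_pair hne]
  congr 1
  ext x
  simp only [Set.mem_ofPred_eq, sqForm_apply, Set.mem_insert_iff, Set.mem_singleton_iff]
  constructor
  · intro h
    have hm : (x - 1) * (x + 1) = 0 := by linear_combination h
    by_cases hx : r (x + 1) = 0
    · right
      have hu : IsUnit (x - 1) := by
        rw [isUnit_iff_castHom_ne_zero hs]
        intro hx'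
        change r (x - 1) = 0 at hx'
        rw [map_add, map_one] at hx
        rw [map_sub, map_one] at hx'
        exact h2 (by linear_combination hx - hx')
      exact eq_neg_of_add_eq_zero_left (hu.mul_right_eq_zero.mp hm)
    · left
      have hu : IsUnit (x + 1) := (isUnit_iff_castHom_ne_zero hs _).mpr hx
      exact sub_eq_zero.mp (hu.mul_left_eq_zero.mp hm)
  · rintro (rfl | rfl) <;> simp

/-- Over `ℤ/p^s`, the form `x ^ 2 + α * y ^ 2` with `α` invertible takes every unit value. -/
theorem exists_double₁_eq_prime_pow {p s : ℕ} [Fact p.Prime] (hp : p ≠ 2) (hs : p ∣ p ^ s)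
    {α : ZMod (p ^ s)} (hα : IsUnit α) (u : ZMod (p ^ s)) (hu : IsUnit u) :
    ∃ x, doubleForm α (sqForm (ZMod (p ^ s))) x = u := by
  let r := ZMod.castHom hs (ZMod p)
  obtain ⟨x₀, y₀, h⟩ := exists_sq_add_mul_sq (by rwa [ZMod.ringChar_zmod_n])
    ((isUnit_iff_castHom_ne_zero hs α).mp hα) (r u)
  obtain ⟨x, rfl⟩ := ZMod.castHom_surjective hs x₀
  obtain ⟨y, rfl⟩ := ZMod.castHom_surjective hs y₀
  have hN : r (x * x + α * (y * y)) = r u := by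
    rw [← h]
    simp only [map_add, map_mul, r]
  have hNu : IsUnit (x * x + α * (y * y)) := by
    rw [isUnit_iff_castHom_ne_zero hs]
    change r _ ≠ 0
    rw [hN]
    exact (isUnit_iff_castHom_ne_zero hs u).mp hu
  obtain ⟨w, hw⟩ := hNu.exists_left_inv
  obtain ⟨t, ht⟩ := isSquare_of_castHom_eq_one hp hs (w * u) (by
    change r _ = 1
    rw [map_mul, ← hN, ← map_mul, hw, map_one])
  refine ⟨(t * x, t * y), ?_⟩
  change (t * x) * (t * x) + α * ((t * y) * (t * y)) = u
  linear_combination -(x * x + α * (y * y)) * ht + u * hw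

theorem castHom_eq_residueDigit {p s : ℕ} [Fact p.Prime] (hs : p ∣ p ^ s) (α : ZMod (p ^ s)) :
    ZMod.castHom hs (ZMod p) α = (residueDigit p α 0 : ZMod p) := by
  have : NeZero (p ^ s) := ⟨pow_ne_zero s (Fact.out : p.Prime).ne_zero⟩
  rw [residueDigit, pow_zero, Nat.div_one, ZMod.natCast_mod, ← map_natCast (ZMod.castHom hs _),
    ZMod.natCast_zmod_val]

theorem count_of_recursion {p s : ℕ} (hp : 2 ≤ p) (hs : 1 ≤ s) {χ ε : ℤ} (hχ : χ ^ 2 = 1)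
    (hε : ε ^ 2 = 1) {Z₁ C₁ Z₂ C₂ Z₃ C₃ I₁ I₂ I₃ U₁ U₂ U₃ : ℕ}
    (hZ₁ : (Z₁ : ℤ) = p + χ * (p - 1) * ε) (hT₁ : Z₁ + (p - 1) * C₁ = p ^ 2)
    (hZ₂ : Z₂ = Z₁ ^ 2 + (p - 1) * C₁ ^ 2) (hT₂ : Z₂ + (p - 1) * C₂ = (p ^ 2) ^ 2)
    (hZ₃ : Z₃ = Z₂ ^ 2 + (p - 1) * C₂ ^ 2) (hT₃ : Z₃ + (p - 1) * C₃ = ((p ^ 2) ^ 2) ^ 2)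
    (hI₁ : I₁ = (p - 1) * C₁ * (p ^ (s - 1)) ^ 2) (hI₂ : I₂ = (p - 1) * C₂ * (p ^ (s - 1)) ^ 4)
    (hI₃ : I₃ = (p - 1) * C₃ * (p ^ (s - 1)) ^ 8) (hU₁ : I₁ = p ^ (s - 1) * (p - 1) * U₁)
    (hU₂ : I₂ = p ^ (s - 1) * (p - 1) * U₂) (hU₃ : I₃ = p ^ (s - 1) * (p - 1) * U₃) :
    (I₁ : ℤ) = (p : ℤ) ^ (2 * s) - (p : ℤ) ^ (2 * (s - 1)) * (p + χ * (p - 1) * ε) ∧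
    (I₂ : ℤ) = (p : ℤ) ^ (4 * s) - (p : ℤ) ^ (4 * (s - 1)) * ((p : ℤ) ^ 3 + (p - 1) * p) ∧
    (I₃ : ℤ) = (p : ℤ) ^ (8 * s) - (p : ℤ) ^ (8 * (s - 1)) *
      ((p : ℤ) ^ 7 + (p - 1) * (p : ℤ) ^ 3) ∧
    (U₁ : ℤ) = (p : ℤ) ^ (s - 1) * (p - χ * ε) ∧
    (U₂ : ℤ) = (p : ℤ) ^ (3 * (s - 1)) * ((p : ℤ) ^ 3 - p) ∧
    (U₃ : ℤ) = (p : ℤ) ^ (7 * (s - 1)) * ((p : ℤ) ^ 7 - (p : ℤ) ^ 3) := by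
  obtain ⟨m, rfl⟩ : ∃ m, s = m + 1 := ⟨s - 1, by omega⟩
  obtain ⟨P, rfl⟩ : ∃ P : ℕ, p = P + 1 := ⟨p - 1, by omega⟩
  have hP : (P : ℤ) ≠ 0 := by norm_cast; omega
  have he : (χ * ε) ^ 2 = 1 := by rw [mul_pow, hχ, hε, one_mul]
  simp only [Nat.add_sub_cancel] at *
  zify at *
  have hK : ((P : ℤ) + 1) ^ m ≠ 0 := by positivity
  have e : ∀ k : ℕ, ((P : ℤ) + 1) ^ (k * (m + 1)) = (((P : ℤ) + 1) ^ m) ^ k * (P + 1) ^ k := by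
    intro k
    rw [← pow_mul, ← pow_add]
    congr 1
    ring
  have e' : ∀ k : ℕ, ((P : ℤ) + 1) ^ (k * m) = (((P : ℤ) + 1) ^ m) ^ k := fun k => by
    rw [← pow_mul, mul_comm]
  simp only [e, e']
  generalize ((P : ℤ) + 1) ^ m = K at *
  have c₁ : (C₁ : ℤ) = P + 1 - χ * ε := by
    apply mul_left_cancel₀ hP
    linear_combination hT₁ - hZ₁
  have c₂ : (C₂ : ℤ) = (P + 1) ^ 3 - (P + 1) := by
    apply mul_left_cancel₀ hP
    rw [c₁, hZ₁] at hZ₂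
    linear_combination hT₂ - hZ₂ - (P ^ 2 + P) * he
  have c₃ : (C₃ : ℤ) = (P + 1) ^ 7 - (P + 1) ^ 3 := by
    apply mul_left_cancel₀ hP
    have z₂ : (Z₂ : ℤ) = (P + 1) ^ 4 - P * ((P + 1) ^ 3 - (P + 1)) := by
      rw [c₂] at hT₂
      linear_combination hT₂
    rw [c₂, z₂] at hZ₃
    linear_combination hT₃ - hZ₃
  rw [c₁] at hI₁
  rw [c₂] at hI₂
  rw [c₃] at hI₃
  have hKP : K * P ≠ 0 := mul_ne_zero hK hP
  refine ⟨by rw [hI₁]; ring, by rw [hI₂]; ring, by rw [hI₃]; ring, ?_, ?_, ?_⟩ <;>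
    apply mul_left_cancel₀ hKP
  · linear_combination hI₁ - hU₁
  · linear_combination hI₂ - hU₂
  · linear_combination hI₃ - hU₃

theorem odd_prime_powers (p : ℕ) [Fact p.Prime] (hp : p ≠ 2) (s : ℕ) (hs : 1 ≤ s)
    (α β γ : ZMod (p ^ s)) (hα : IsUnit α) (hβ : IsUnit β) (hγ : IsUnit γ) :
    (scalarInvertibles (ZMod (p ^ s)) (ZMod (p ^ s))).ncard = p ^ (s - 1) * (p - 1) ∧
    (scalarInvertibles (ZMod (p ^ s)) (CayleyInt₁ (p ^ s) α)).ncard =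
      p ^ (s - 1) * (p - 1) ∧
    (scalarInvertibles (ZMod (p ^ s)) (CayleyInt₂ (p ^ s) α β)).ncard =
      p ^ (s - 1) * (p - 1) ∧
    (scalarInvertibles (ZMod (p ^ s)) (CayleyInt₃ (p ^ s) α β γ)).ncard =
      p ^ (s - 1) * (p - 1) ∧
    (invertibles (ZMod (p ^ s))).ncard = p ^ (s - 1) * (p - 1) ∧
    ((invertibles (CayleyInt₁ (p ^ s) α)).ncard : ℤ) =
      (p : ℤ) ^ (2 * s) - (p : ℤ) ^ (2 * (s - 1)) *
        ((p : ℤ) + legendreSym p (residueDigit p α 0) * ((p : ℤ) - 1) *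
          (-1) ^ ((p - 1) / 2)) ∧
    ((invertibles (CayleyInt₂ (p ^ s) α β)).ncard : ℤ) =
      (p : ℤ) ^ (4 * s) - (p : ℤ) ^ (4 * (s - 1)) *
        ((p : ℤ) ^ 3 + ((p : ℤ) - 1) * p) ∧
    ((invertibles (CayleyInt₃ (p ^ s) α β γ)).ncard : ℤ) =
      (p : ℤ) ^ (8 * s) - (p : ℤ) ^ (8 * (s - 1)) *
        ((p : ℤ) ^ 7 + ((p : ℤ) - 1) * (p : ℤ) ^ 3) ∧
    (unimodulars (ZMod (p ^ s)) (ZMod (p ^ s))).ncard = 2 ∧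
    ((unimodulars (ZMod (p ^ s)) (CayleyInt₁ (p ^ s) α)).ncard : ℤ) =
      (p : ℤ) ^ (s - 1) *
        ((p : ℤ) - legendreSym p (residueDigit p α 0) * (-1) ^ ((p - 1) / 2)) ∧
    ((unimodulars (ZMod (p ^ s)) (CayleyInt₂ (p ^ s) α β)).ncard : ℤ) =
      (p : ℤ) ^ (3 * (s - 1)) * ((p : ℤ) ^ 3 - p) ∧
    ((unimodulars (ZMod (p ^ s)) (CayleyInt₃ (p ^ s) α β γ)).ncard : ℤ) =
      (p : ℤ) ^ (7 * (s - 1)) * ((p : ℤ) ^ 7 - (p : ℤ) ^ 3) := by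
  have hpp : p.Prime := Fact.out
  have : NeZero (p ^ s) := ⟨pow_ne_zero s hpp.ne_zero⟩
  have hd : p ∣ p ^ s := dvd_pow_self p (by omega)
  have hu := ncard_isUnit_prime_pow hd
  -- the residue field
  set a := ZMod.castHom hd (ZMod p) α with ha
  set b := ZMod.castHom hd (ZMod p) β with hb
  set c := ZMod.castHom hd (ZMod p) γ with hc
  have ha0 : a ≠ 0 := (isUnit_iff_castHom_ne_zero hd α).mp hα
  have hb0 : b ≠ 0 := (isUnit_iff_castHom_ne_zero hd β).mp hβ
  have hc0 : c ≠ 0 := (isUnit_iff_castHom_ne_zero hd γ).mp hγ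
  have s₁ : ∀ u : ZMod p, IsUnit u → ∃ x, doubleForm a (sqForm (ZMod p)) x = u := by
    intro u _
    obtain ⟨x, y, h⟩ := exists_sq_add_mul_sq (by rwa [ZMod.ringChar_zmod_n]) ha0 u
    exact ⟨(x, y), h⟩
  have z₁ : doubleForm a (sqForm (ZMod p)) 0 = 0 := doubleForm_zero sqForm_zero a
  have z₂ := doubleForm_zero z₁ b
  have s₂ := exists_double_eq z₁ s₁ b
  have s₃ := exists_double_eq z₂ s₂ c
  have f₁ := (isNormForm_double₁ a).ncard_fiber_of_surjective s₁
  have f₂ := (isNormForm_double₂ a b).ncard_fiber_of_surjective s₂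
  have f₃ := (isNormForm_double₃ a b c).ncard_fiber_of_surjective s₃
  have Z₁ := ncard_sq_add_mul_sq hp (residueDigit p α 0)
    (by rw [← castHom_eq_residueDigit hd]; exact ha0)
  rw [← castHom_eq_residueDigit hd, ← ha] at Z₁
  have Z₂ := ncard_doubleForm_zero f₁ hb0
  have Z₃ := ncard_doubleForm_zero f₂ hc0
  have T₁ := ncard_form_zero_add f₁
  have T₂ := ncard_form_zero_add f₂
  have T₃ := ncard_form_zero_add f₃
  -- the ring of integers modulo `p ^ s`
  have S₁ := exists_double₁_eq_prime_pow hp hd hα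
  have Y₁ : doubleForm α (sqForm (ZMod (p ^ s))) 0 = 0 := doubleForm_zero sqForm_zero α
  have S₂ := exists_double_eq Y₁ S₁ β
  have S₃ := exists_double_eq (doubleForm_zero Y₁ β) S₂ γ
  have I₁ := ncard_isUnit_double₁ hd α
  have I₂ := ncard_isUnit_double₂ hd α β
  have I₃ := ncard_isUnit_double₃ hd α β γ
  rw [← ha, ncard_form_ne_zero f₁] at I₁
  rw [← ha, ← hb, ncard_form_ne_zero f₂] at I₂
  rw [← ha, ← hb, ← hc, ncard_form_ne_zero f₃] at I₃
  have U₁ := (isNormForm_double₁ α).ncard_isUnit_of_surjective S₁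
  have U₂ := (isNormForm_double₂ α β).ncard_isUnit_of_surjective S₂
  have U₃ := (isNormForm_double₃ α β γ).ncard_isUnit_of_surjective S₃
  simp only [isNormForm_sqForm.unimodulars_eq, (isNormForm_double₁ _).unimodulars_eq,
    (isNormForm_double₂ _ _).unimodulars_eq, (isNormForm_double₃ _ _ _).unimodulars_eq,
    invertibles_eq_isUnit, (isNormForm_double₁ _).invertibles_eq,
    (isNormForm_double₂ _ _).invertibles_eq, (isNormForm_double₃ _ _ _).invertibles_eq,
    isNormForm_sqForm.ncard_scalarInvertibles, (isNormForm_double₁ _).ncard_scalarInvertibles,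
    (isNormForm_double₂ _ _).ncard_scalarInvertibles,
    (isNormForm_double₃ _ _ _).ncard_scalarInvertibles]
  refine ⟨hu, hu, hu, hu, hu, ?_⟩
  rw [hu] at U₁ U₂ U₃
  simp only [nat_card_double, Nat.card_zmod] at Z₁ Z₂ Z₃ T₁ T₂ T₃ I₁ I₂ I₃
  have hχ : legendreSym p (residueDigit p α 0) ^ 2 = 1 := by
    apply legendreSym.sq_one
    rw [Int.cast_natCast, ← castHom_eq_residueDigit hd]
    exact ha0
  have hε : ((-1 : ℤ) ^ ((p - 1) / 2)) ^ 2 = 1 := by rw [← pow_mul, mul_comm, pow_mul]; simp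
  obtain ⟨h1, h2, h3, h4, h5, h6⟩ := count_of_recursion hpp.two_le hs hχ hε Z₁ T₁ Z₂ T₂ Z₃ T₃
    I₁ I₂ I₃ U₁ U₂ U₃
  exact ⟨h1, h2, h3, ncard_mul_self_eq_one hp hd, h4, h5, h6⟩

theorem exists_two_pow_dvd_sq_sub (s : ℕ) {a : ℤ} (ha : 8 ∣ a - 1) :
    ∃ b : ℤ, 2 ^ (s + 3) ∣ b * b - a := by
  induction s with
  | zero =>
    obtain ⟨k, hk⟩ := ha
    exact ⟨1, -k, by linear_combination -hk⟩
  | succ s ih =>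
    obtain ⟨b, k, hk⟩ := ih
    obtain ⟨l, hl⟩ := ha
    rcases Int.even_or_odd' k with ⟨n, rfl | rfl⟩
    · exact ⟨b, n, by rw [hk]; ring⟩
    · have hb : Odd b := by
        by_contra hb
        obtain ⟨c, hc⟩ := (Int.not_odd_iff_even.mp hb).two_dvd
        have : 2 * (2 * c * c - 2 ^ (s + 2) * (2 * n + 1) - 4 * l) = 1 := by
          rw [hc] at hk
          linear_combination hk + hl
        omega
      obtain ⟨c, hc⟩ := hb
      refine ⟨b + 2 ^ (s + 2), n + c + 1 + 2 ^ s, ?_⟩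
      linear_combination hk + 2 ^ (s + 3) * hc

theorem isSquare_intCast_zmod_two_pow (s : ℕ) {a : ℤ} (ha : 8 ∣ a - 1) :
    IsSquare (a : ZMod (2 ^ s)) := by
  obtain ⟨b, hb⟩ := exists_two_pow_dvd_sq_sub s ha
  refine ⟨b, ?_⟩
  have h : ((2 ^ s : ℕ) : ℤ) ∣ b * b - a := by
    refine Dvd.dvd.trans ?_ hb
    push_cast
    exact pow_dvd_pow 2 (by omega)
  rw [← ZMod.intCast_zmod_eq_zero_iff_dvd] at h
  push_cast at h
  exact (sub_eq_zero.mp h).symm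

theorem isUnit_natCast_zmod_two_pow {n : ℕ} (hn : n % 2 = 1) (s : ℕ) :
    IsUnit (n : ZMod (2 ^ s)) :=
  (ZMod.isUnit_iff_coprime n (2 ^ s)).mpr
    (Nat.Coprime.pow_right s (Nat.coprime_two_right.mpr (Nat.odd_iff.mpr hn)))

theorem val_mod_two_of_isUnit {s : ℕ} (hs : 1 ≤ s) {u : ZMod (2 ^ s)} (hu : IsUnit u) :
    u.val % 2 = 1 := by
  rw [← ZMod.natCast_zmod_val u, ZMod.isUnit_iff_coprime,
    Nat.coprime_pow_right_iff (by omega), Nat.coprime_two_right] at hu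
  exact Nat.odd_iff.mp hu

/-- A value modulo `8` of a quadratic form differs from an odd `u` by a square modulo `2 ^ s`. -/
theorem exists_sq_mul_eq (s : ℕ) {N u : ℕ} (hu : u % 2 = 1) (h : (N : ZMod 8) = u) :
    ∃ t : ZMod (2 ^ s), t * t * N = u := by
  have h8 : N % 8 = u % 8 := (ZMod.natCast_eq_natCast_iff' _ _ _).mp h
  obtain ⟨w, hw⟩ := (isUnit_natCast_zmod_two_pow (n := N) (by omega) s).exists_left_inv
  have hd : (8 : ℤ) ∣ ((u * N : ℕ) : ℤ) - 1 := by
    have h1 : u * N % 8 = 1 := by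
      rw [Nat.mul_mod, h8]
      have : u % 8 = 1 ∨ u % 8 = 3 ∨ u % 8 = 5 ∨ u % 8 = 7 := by omega
      rcases this with h | h | h | h <;> rw [h]
    omega
  obtain ⟨t, ht⟩ := isSquare_intCast_zmod_two_pow s hd
  push_cast at ht
  refine ⟨t * w, ?_⟩
  linear_combination (-w * w * N) * ht + (u * (w * N + 1)) * hw

theorem exists_double₁_eq_two_pow (s : ℕ) {α u : ZMod (2 ^ s)} (hu : u.val % 2 = 1)
    (h : ∃ x y : ZMod 8, x * x + α.val * (y * y) = u.val) :
    ∃ x, doubleForm α (sqForm (ZMod (2 ^ s))) x = u := by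
  obtain ⟨x, y, h⟩ := h
  obtain ⟨t, ht⟩ := exists_sq_mul_eq s (N := x.val * x.val + α.val * (y.val * y.val)) hu
    (by push_cast; simpa only [ZMod.natCast_zmod_val] using h)
  push_cast at ht
  rw [ZMod.natCast_zmod_val, ZMod.natCast_zmod_val] at ht
  refine ⟨(t * x.val, t * y.val), ?_⟩
  change (t * x.val) * (t * x.val) + α * ((t * y.val) * (t * y.val)) = u
  linear_combination ht

theorem exists_double₂_eq_two_pow (s : ℕ) {α β u : ZMod (2 ^ s)} (hu : u.val % 2 = 1)
    (h : ∃ x y z w : ZMod 8,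
      x * x + α.val * (y * y) + β.val * (z * z + α.val * (w * w)) = u.val) :
    ∃ x, doubleForm β (doubleForm α (sqForm (ZMod (2 ^ s)))) x = u := by
  obtain ⟨x, y, z, w, h⟩ := h
  obtain ⟨t, ht⟩ := exists_sq_mul_eq s (N := x.val * x.val + α.val * (y.val * y.val) +
    β.val * (z.val * z.val + α.val * (w.val * w.val))) hu
    (by push_cast; simpa only [ZMod.natCast_zmod_val] using h)
  push_cast at ht
  simp only [ZMod.natCast_zmod_val α, ZMod.natCast_zmod_val β, ZMod.natCast_zmod_val u] at ht
  refine ⟨((t * x.val, t * y.val), (t * z.val, t * w.val)), ?_⟩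
  change (t * x.val) * (t * x.val) + α * ((t * y.val) * (t * y.val)) +
    β * ((t * z.val) * (t * z.val) + α * ((t * w.val) * (t * w.val))) = u
  linear_combination ht

theorem quaternary_form_mod_eight : ∀ a b u : ZMod 8, a * a = 1 → b * b = 1 → u * u = 1 →
    ∃ x y z w : Fin 3, ((x.val : ZMod 8) * x.val + a * (y.val * y.val)) +
      b * (z.val * z.val + a * (w.val * w.val)) = u := by
  decide +kernel

theorem binary_form_mod_eight : ∀ a u : ZMod 8, (a = 3 ∨ a = 7) → u * u = 1 →
    ∃ x y : ZMod 8, x * x + a * (y * y) = u := by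
  decide

theorem binary_form_mod_eight' : ∀ a u : ZMod 8, (a = 1 ∨ a = 5) → (u = 1 ∨ u = 5) →
    ∃ x y : ZMod 8, x * x + a * (y * y) = u := by
  decide

theorem natCast_mod_eight {n r : ℕ} (h : n % 8 = r) : (n : ZMod 8) = (r : ZMod 8) := by
  rw [← h, ZMod.natCast_mod]

theorem natCast_mul_self_mod_eight {n : ℕ} (h : n % 2 = 1) : (n : ZMod 8) * n = 1 := by
  have : n % 8 = 1 ∨ n % 8 = 3 ∨ n % 8 = 5 ∨ n % 8 = 7 := by omega
  rcases this with h | h | h | h <;> rw [natCast_mod_eight h] <;> decide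

theorem exists_double₂_eq_two_pow_of_isUnit {s : ℕ} (hs : 1 ≤ s) {α β : ZMod (2 ^ s)}
    (hα : IsUnit α) (hβ : IsUnit β) (u : ZMod (2 ^ s)) (hu : IsUnit u) :
    ∃ x, doubleForm β (doubleForm α (sqForm (ZMod (2 ^ s)))) x = u := by
  have hu' := val_mod_two_of_isUnit hs hu
  obtain ⟨x, y, z, w, h⟩ := quaternary_form_mod_eight _ _ _
    (natCast_mul_self_mod_eight (val_mod_two_of_isUnit hs hα))
    (natCast_mul_self_mod_eight (val_mod_two_of_isUnit hs hβ)) (natCast_mul_self_mod_eight hu')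
  exact exists_double₂_eq_two_pow s hu' ⟨_, _, _, _, h⟩

theorem exists_double₁_eq_two_pow_of_mod_four {s : ℕ} (hs : 1 ≤ s) {α : ZMod (2 ^ s)}
    (hα : α.val % 4 = 3) (u : ZMod (2 ^ s)) (hu : IsUnit u) :
    ∃ x, doubleForm α (sqForm (ZMod (2 ^ s))) x = u := by
  have hu' := val_mod_two_of_isUnit hs hu
  refine exists_double₁_eq_two_pow s hu' (binary_form_mod_eight _ _ ?_
    (natCast_mul_self_mod_eight hu'))
  have : α.val % 8 = 3 ∨ α.val % 8 = 7 := by omega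
  exact this.imp natCast_mod_eight natCast_mod_eight

theorem castHom_two_pow_eq_one_iff {s t : ℕ} (ht : 1 ≤ t) (hts : t ≤ s) (u : ZMod (2 ^ s)) :
    ZMod.castHom (pow_dvd_pow 2 hts) (ZMod (2 ^ t)) u = 1 ↔ u.val % 2 ^ t = 1 := by
  conv_lhs => rw [← ZMod.natCast_zmod_val u, map_natCast, ← Nat.cast_one]
  rw [ZMod.natCast_eq_natCast_iff', Nat.mod_eq_of_lt (Nat.one_lt_two_pow (by omega))]

/-- For `α ≡ 1` modulo `4`, the units of the form `x ^ 2 + α * y ^ 2` are those congruent to `1`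
modulo `4`. -/
theorem ncard_unit_values_double₁ {s : ℕ} (hs : 2 ≤ s) {α : ZMod (2 ^ s)}
    (hα : α.val % 4 = 1) :
    {u | IsUnit u ∧ ∃ x, doubleForm α (sqForm (ZMod (2 ^ s))) x = u}.ncard = 2 ^ (s - 2) := by
  let r := ZMod.castHom (pow_dvd_pow 2 hs) (ZMod (2 ^ 2))
  have hrα : r α = 1 := (castHom_two_pow_eq_one_iff (by omega) hs α).mpr hα
  rw [← ncard_fiber_castHom (p := 2) hs 1]
  congr 1
  ext u
  change _ ↔ r u = 1
  constructor
  · rintro ⟨hu, x, rfl⟩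
    obtain ⟨w, hw⟩ := hu.exists_right_inv
    have hw' := congrArg r hw
    have hx : r (doubleForm α (sqForm (ZMod (2 ^ s))) x) =
        r x.1 * r x.1 + r x.2 * r x.2 := by
      rw [doubleForm_apply, map_add, map_mul, hrα, one_mul, sqForm_apply, sqForm_apply,
        map_mul, map_mul]
    rw [map_mul, map_one, hx] at hw'
    rw [hx]
    have key : ∀ x y w : ZMod (2 ^ 2), (x * x + y * y) * w = 1 → x * x + y * y = 1 := by decide
    exact key _ _ _ hw'
  · intro hu
    have hu4 : u.val % 4 = 1 := (castHom_two_pow_eq_one_iff (by omega) hs u).mp hu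
    refine ⟨?_, exists_double₁_eq_two_pow s (by omega) (binary_form_mod_eight' _ _ ?_ ?_)⟩
    · rw [← ZMod.natCast_zmod_val u]
      exact isUnit_natCast_zmod_two_pow (by omega) s
    · have : α.val % 8 = 1 ∨ α.val % 8 = 5 := by omega
      exact this.imp (fun h => by simpa using natCast_mod_eight h) natCast_mod_eight
    · have : u.val % 8 = 1 ∨ u.val % 8 = 5 := by omega
      exact this.imp (fun h => by simpa using natCast_mod_eight h) natCast_mod_eight

/-- The odd squares modulo `2 ^ s` are the classes congruent to `1` modulo `8`. -/
theorem ncard_unit_squares {s : ℕ} (hs : 3 ≤ s) :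
    {u | IsUnit u ∧ ∃ x, sqForm (ZMod (2 ^ s)) x = u}.ncard = 2 ^ (s - 3) := by
  let r := ZMod.castHom (pow_dvd_pow 2 hs) (ZMod (2 ^ 3))
  rw [← ncard_fiber_castHom (p := 2) hs 1]
  congr 1
  ext u
  change _ ↔ r u = 1
  constructor
  · rintro ⟨hu, x, rfl⟩
    obtain ⟨w, hw⟩ := hu.exists_right_inv
    have hw' := congrArg r hw
    rw [sqForm_apply, map_mul, map_mul, map_one] at hw'
    rw [sqForm_apply, map_mul]
    have key : ∀ x w : ZMod (2 ^ 3), (x * x) * w = 1 → x * x = 1 := by decide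
    exact key _ _ hw'
  · intro hu
    have hu8 : u.val % 8 = 1 := (castHom_two_pow_eq_one_iff (by omega) hs u).mp hu
    refine ⟨?_, ?_⟩
    · rw [← ZMod.natCast_zmod_val u]
      exact isUnit_natCast_zmod_two_pow (by omega) s
    · obtain ⟨t, ht⟩ := isSquare_intCast_zmod_two_pow s (a := u.val) (by omega)
      rw [Int.cast_natCast, ZMod.natCast_zmod_val] at ht
      exact ⟨t, ht.symm⟩

theorem powers_of_two (s : ℕ) (hs : 1 ≤ s) (α β γ : ZMod (2 ^ s)) (hα : IsUnit α)
    (hβ : IsUnit β) (hγ : IsUnit γ) :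
    (scalarInvertibles (ZMod (2 ^ s)) (ZMod (2 ^ s))).ncard = 2 ^ (s - 1) ∧
    (scalarInvertibles (ZMod (2 ^ s)) (CayleyInt₁ (2 ^ s) α)).ncard = 2 ^ (s - 1) ∧
    (scalarInvertibles (ZMod (2 ^ s)) (CayleyInt₂ (2 ^ s) α β)).ncard = 2 ^ (s - 1) ∧
    (scalarInvertibles (ZMod (2 ^ s)) (CayleyInt₃ (2 ^ s) α β γ)).ncard = 2 ^ (s - 1) ∧
    (invertibles (ZMod (2 ^ s))).ncard = 2 ^ (s - 1) ∧
    (invertibles (CayleyInt₁ (2 ^ s) α)).ncard = 2 ^ (2 * s - 1) ∧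
    (invertibles (CayleyInt₂ (2 ^ s) α β)).ncard = 2 ^ (4 * s - 1) ∧
    (invertibles (CayleyInt₃ (2 ^ s) α β γ)).ncard = 2 ^ (8 * s - 1) ∧
    (s = 1 → (unimodulars (ZMod (2 ^ s)) (ZMod (2 ^ s))).ncard = 1) ∧
    (s = 2 → (unimodulars (ZMod (2 ^ s)) (ZMod (2 ^ s))).ncard = 2) ∧
    (3 ≤ s → (unimodulars (ZMod (2 ^ s)) (ZMod (2 ^ s))).ncard = 4) ∧
    (s = 1 → (unimodulars (ZMod (2 ^ s)) (CayleyInt₁ (2 ^ s) α)).ncard = 2) ∧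
    (2 ≤ s → (unimodulars (ZMod (2 ^ s)) (CayleyInt₁ (2 ^ s) α)).ncard =
      2 ^ (s + 1 - residueDigit 2 α 1)) ∧
    (unimodulars (ZMod (2 ^ s)) (CayleyInt₂ (2 ^ s) α β)).ncard = 2 ^ (3 * s) ∧
    (unimodulars (ZMod (2 ^ s)) (CayleyInt₃ (2 ^ s) α β γ)).ncard = 2 ^ (7 * s) := by
  have hd : 2 ∣ 2 ^ s := dvd_pow_self 2 (by omega)
  have hu := ncard_isUnit_prime_pow hd
  rw [show 2 - 1 = 1 from rfl, mul_one] at hu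
  -- the residue field
  have hone : ∀ {x : ZMod 2}, x ≠ 0 → x = 1 := by decide
  have h1 : ∀ {x : ZMod (2 ^ s)}, IsUnit x → ZMod.castHom hd (ZMod 2) x = 1 := fun {x} hx =>
    hone ((isUnit_iff_castHom_ne_zero hd x).mp hx)
  have hsurj : ∀ {E : Type} {q : E → ZMod 2} (e : E), q e = 1 →
      ∀ u : ZMod 2, IsUnit u → ∃ x, q x = u := fun {E q} e he u hu =>
    ⟨e, by rw [he, hone hu.ne_zero]⟩
  have N₁ := isNormForm_double₁ (1 : ZMod 2)
  have N₂ := isNormForm_double₂ (1 : ZMod 2) 1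
  have N₃ := isNormForm_double₃ (1 : ZMod 2) 1 1
  have f₀ := isNormForm_sqForm.ncard_fiber_of_surjective
    (hsurj _ (isNormForm_sqForm (A := ZMod 2)).map_one)
  have f₁ := N₁.ncard_fiber_of_surjective (hsurj _ N₁.map_one)
  have f₂ := N₂.ncard_fiber_of_surjective (hsurj _ N₂.map_one)
  have f₃ := N₃.ncard_fiber_of_surjective (hsurj _ N₃.map_one)
  have Z₀ : {x | sqForm (ZMod 2) x = 0}.ncard = 1 := by
    rw [Set.ncard_eq_one]
    exact ⟨0, by ext x; simp [sqForm_apply]⟩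
  have Z₁ := ncard_doubleForm_zero f₀ one_ne_zero
  have Z₂ := ncard_doubleForm_zero f₁ one_ne_zero
  have Z₃ := ncard_doubleForm_zero f₂ one_ne_zero
  have T₀ := ncard_form_zero_add f₀
  have T₁ := ncard_form_zero_add f₁
  have T₂ := ncard_form_zero_add f₂
  have T₃ := ncard_form_zero_add f₃
  simp only [nat_card_double, Nat.card_zmod, Nat.add_one_sub_one, one_mul] at Z₁ Z₂ Z₃ T₀ T₁ T₂ T₃
  have C₀ : {x | sqForm (ZMod 2) x = 1}.ncard = 1 := by omega
  rw [Z₀, C₀] at Z₁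
  have C₁ : {x | doubleForm 1 (sqForm (ZMod 2)) x = 1}.ncard = 2 := by omega
  rw [Z₁, C₁] at Z₂
  have C₂ : {x | doubleForm 1 (doubleForm 1 (sqForm (ZMod 2))) x = 1}.ncard = 8 := by omega
  rw [Z₂, C₂] at Z₃
  have C₃ : {x | doubleForm 1 (doubleForm 1 (doubleForm 1 (sqForm (ZMod 2)))) x = 1}.ncard =
    128 := by omega
  -- the ring of integers modulo `2 ^ s`
  have I₁ := ncard_isUnit_double₁ hd α
  have I₂ := ncard_isUnit_double₂ hd α β
  have I₃ := ncard_isUnit_double₃ hd α β γ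
  rw [h1 hα, ncard_form_ne_zero f₁, C₁, Nat.card_zmod] at I₁
  rw [h1 hα, h1 hβ, ncard_form_ne_zero f₂, C₂, Nat.card_zmod] at I₂
  rw [h1 hα, h1 hβ, h1 hγ, ncard_form_ne_zero f₃, C₃, Nat.card_zmod] at I₃
  have S₂ := exists_double₂_eq_two_pow_of_isUnit hs hα hβ
  have S₃ := exists_double_eq (doubleForm_zero (doubleForm_zero sqForm_zero α) β) S₂ γ
  have U₀ := (isNormForm_sqForm (A := ZMod (2 ^ s))).ncard_isUnit
  have U₁ := (isNormForm_double₁ α).ncard_isUnit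
  have U₂ := (isNormForm_double₂ α β).ncard_isUnit_of_surjective S₂
  have U₃ := (isNormForm_double₃ α β γ).ncard_isUnit_of_surjective S₃
  simp only [isNormForm_sqForm.unimodulars_eq, (isNormForm_double₁ _).unimodulars_eq,
    (isNormForm_double₂ _ _).unimodulars_eq, (isNormForm_double₃ _ _ _).unimodulars_eq,
    invertibles_eq_isUnit, (isNormForm_double₁ _).invertibles_eq,
    (isNormForm_double₂ _ _).invertibles_eq, (isNormForm_double₃ _ _ _).invertibles_eq,
    isNormForm_sqForm.ncard_scalarInvertibles, (isNormForm_double₁ _).ncard_scalarInvertibles,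
    (isNormForm_double₂ _ _).ncard_scalarInvertibles,
    (isNormForm_double₃ _ _ _).ncard_scalarInvertibles]
  have I₀ : {x : ZMod (2 ^ s) | IsUnit (sqForm (ZMod (2 ^ s)) x)}.ncard = 2 ^ (s - 1) := by
    rw [← hu]
    congr 1
    ext x
    simp [sqForm_apply]
  rw [hu, I₂] at U₂
  rw [hu, I₃] at U₃
  rw [I₀] at U₀
  rw [I₁] at U₁
  obtain ⟨m, rfl⟩ : ∃ m, s = m + 1 := ⟨s - 1, by omega⟩
  rw [Nat.add_sub_cancel] at *
  have hm : 0 < 2 ^ m := by positivity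
  refine ⟨hu, hu, hu, hu, hu, ?_, ?_, ?_, ?_, ?_, ?_, ?_, ?_, ?_, ?_⟩
  · rw [I₁, show 2 * (m + 1) - 1 = m * 2 + 1 by omega, pow_add, pow_mul]
    ring
  · rw [I₂, show 4 * (m + 1) - 1 = m * 4 + 3 by omega, pow_add, pow_mul]
    ring
  · rw [I₃, show 8 * (m + 1) - 1 = m * 8 + 7 by omega, pow_add, pow_mul]
    ring
  · intro h
    obtain rfl : m = 0 := by omega
    rw [Set.ncard_eq_one]
    have key : ∀ x : ZMod (2 ^ (0 + 1)), x * x = 1 ↔ x = 1 := by decide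
    exact ⟨1, Set.ext key⟩
  · intro h
    obtain rfl : m = 1 := by omega
    have key : ∀ x : ZMod (2 ^ (1 + 1)), x * x = 1 ↔ (x = 1 ∨ x = 3) := by decide
    exact (congrArg Set.ncard (Set.ext key)).trans (Set.ncard_pair (by decide))
  · intro h
    rw [ncard_unit_squares h] at U₀
    obtain ⟨k, rfl⟩ : ∃ k, m = k + 2 := ⟨m - 2, by omega⟩
    refine Nat.eq_of_mul_eq_mul_left (show 0 < 2 ^ k by positivity) ?_
    rw [show k + 2 + 1 - 3 = k by omega] at U₀
    rw [← U₀]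
    ring
  · intro h
    obtain rfl : m = 0 := by omega
    have hle : {u | IsUnit u ∧ ∃ x, doubleForm α (sqForm (ZMod (2 ^ (0 + 1)))) x = u} = {1} := by
      have key : ∀ u : ZMod (2 ^ (0 + 1)), u = 1 ∨ u = 0 := by decide
      ext u
      constructor
      · rintro ⟨hu, -⟩
        rcases key u with h | h
        · exact h
        · rw [h] at hu
          exact absurd (isUnit_zero_iff.mp hu) (by decide)
      · rintro rfl
        exact ⟨isUnit_one, _, (isNormForm_double₁ α).map_one⟩
    rw [hle, Set.ncard_singleton] at U₁
    omega
  · intro h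
    have hodd := val_mod_two_of_isUnit hs hα
    have hdig : residueDigit 2 α 1 = α.val / 2 % 2 := rfl
    rcases (by omega : α.val % 4 = 1 ∨ α.val % 4 = 3) with h4 | h4
    · rw [ncard_unit_values_double₁ h h4] at U₁
      obtain ⟨k, rfl⟩ : ∃ k, m = k + 1 := ⟨m - 1, by omega⟩
      rw [show k + 1 + 1 - 2 = k by omega] at U₁
      rw [hdig, show α.val / 2 % 2 = 0 by omega]
      refine Nat.eq_of_mul_eq_mul_left (show 0 < 2 ^ k by positivity) ?_
      rw [← U₁]
      simp only [Nat.sub_zero]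
      ring
    · have U₁' := (isNormForm_double₁ α).ncard_isUnit_of_surjective
        (exists_double₁_eq_two_pow_of_mod_four hs h4)
      rw [hu, I₁] at U₁'
      rw [hdig, show α.val / 2 % 2 = 1 by omega]
      refine Nat.eq_of_mul_eq_mul_left hm ?_
      rw [← U₁', Nat.add_sub_cancel]
      ring
  · refine Nat.eq_of_mul_eq_mul_left hm ?_
    rw [← U₂]
    ring
  · refine Nat.eq_of_mul_eq_mul_left hm ?_
    rw [← U₃]
    ring

theorem mainTheorem6 :
    -- multiplicativity over pairwise coprime factors
    (∀ (k : ℕ) (m : Fin k → ℕ), (∀ i, 1 ≤ m i) → (∀ i j, i ≠ j → Nat.Coprime (m i) (m j)) →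
      ∀ α β γ : ZMod (∏ i, m i),
        (invertibles (ZMod (∏ i, m i))).ncard = ∏ i, (invertibles (ZMod (m i))).ncard ∧
        (invertibles (CayleyInt₁ (∏ i, m i) α)).ncard =
          ∏ i, (invertibles (CayleyInt₁ (m i) (residueProj m i α))).ncard ∧
        (invertibles (CayleyInt₂ (∏ i, m i) α β)).ncard =
          ∏ i, (invertibles
            (CayleyInt₂ (m i) (residueProj m i α) (residueProj m i β))).ncard ∧
        (invertibles (CayleyInt₃ (∏ i, m i) α β γ)).ncard =
          ∏ i, (invertibles (CayleyInt₃ (m i)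
            (residueProj m i α) (residueProj m i β) (residueProj m i γ))).ncard ∧
        (unimodulars (ZMod (∏ i, m i)) (ZMod (∏ i, m i))).ncard =
          ∏ i, (unimodulars (ZMod (m i)) (ZMod (m i))).ncard ∧
        (unimodulars (ZMod (∏ i, m i)) (CayleyInt₁ (∏ i, m i) α)).ncard =
          ∏ i, (unimodulars (ZMod (m i)) (CayleyInt₁ (m i) (residueProj m i α))).ncard ∧
        (unimodulars (ZMod (∏ i, m i)) (CayleyInt₂ (∏ i, m i) α β)).ncard =
          ∏ i, (unimodulars (ZMod (m i))
            (CayleyInt₂ (m i) (residueProj m i α) (residueProj m i β))).ncard ∧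
        (unimodulars (ZMod (∏ i, m i)) (CayleyInt₃ (∏ i, m i) α β γ)).ncard =
          ∏ i, (unimodulars (ZMod (m i)) (CayleyInt₃ (m i)
            (residueProj m i α) (residueProj m i β) (residueProj m i γ))).ncard) ∧
    -- odd prime powers
    (∀ (p : ℕ) [Fact p.Prime], p ≠ 2 → ∀ s : ℕ, 1 ≤ s →
      ∀ α β γ : ZMod (p ^ s), IsUnit α → IsUnit β → IsUnit γ →
        (scalarInvertibles (ZMod (p ^ s)) (ZMod (p ^ s))).ncard = p ^ (s - 1) * (p - 1) ∧
        (scalarInvertibles (ZMod (p ^ s)) (CayleyInt₁ (p ^ s) α)).ncard =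
          p ^ (s - 1) * (p - 1) ∧
        (scalarInvertibles (ZMod (p ^ s)) (CayleyInt₂ (p ^ s) α β)).ncard =
          p ^ (s - 1) * (p - 1) ∧
        (scalarInvertibles (ZMod (p ^ s)) (CayleyInt₃ (p ^ s) α β γ)).ncard =
          p ^ (s - 1) * (p - 1) ∧
        (invertibles (ZMod (p ^ s))).ncard = p ^ (s - 1) * (p - 1) ∧
        ((invertibles (CayleyInt₁ (p ^ s) α)).ncard : ℤ) =
          (p : ℤ) ^ (2 * s) - (p : ℤ) ^ (2 * (s - 1)) *
            ((p : ℤ) + legendreSym p (residueDigit p α 0) * ((p : ℤ) - 1) *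
              (-1) ^ ((p - 1) / 2)) ∧
        ((invertibles (CayleyInt₂ (p ^ s) α β)).ncard : ℤ) =
          (p : ℤ) ^ (4 * s) - (p : ℤ) ^ (4 * (s - 1)) *
            ((p : ℤ) ^ 3 + ((p : ℤ) - 1) * p) ∧
        ((invertibles (CayleyInt₃ (p ^ s) α β γ)).ncard : ℤ) =
          (p : ℤ) ^ (8 * s) - (p : ℤ) ^ (8 * (s - 1)) *
            ((p : ℤ) ^ 7 + ((p : ℤ) - 1) * (p : ℤ) ^ 3) ∧
        (unimodulars (ZMod (p ^ s)) (ZMod (p ^ s))).ncard = 2 ∧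
        ((unimodulars (ZMod (p ^ s)) (CayleyInt₁ (p ^ s) α)).ncard : ℤ) =
          (p : ℤ) ^ (s - 1) *
            ((p : ℤ) - legendreSym p (residueDigit p α 0) * (-1) ^ ((p - 1) / 2)) ∧
        ((unimodulars (ZMod (p ^ s)) (CayleyInt₂ (p ^ s) α β)).ncard : ℤ) =
          (p : ℤ) ^ (3 * (s - 1)) * ((p : ℤ) ^ 3 - p) ∧
        ((unimodulars (ZMod (p ^ s)) (CayleyInt₃ (p ^ s) α β γ)).ncard : ℤ) =
          (p : ℤ) ^ (7 * (s - 1)) * ((p : ℤ) ^ 7 - (p : ℤ) ^ 3)) ∧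
    -- powers of two
    (∀ s : ℕ, 1 ≤ s →
      ∀ α β γ : ZMod (2 ^ s), IsUnit α → IsUnit β → IsUnit γ →
        (scalarInvertibles (ZMod (2 ^ s)) (ZMod (2 ^ s))).ncard = 2 ^ (s - 1) ∧
        (scalarInvertibles (ZMod (2 ^ s)) (CayleyInt₁ (2 ^ s) α)).ncard = 2 ^ (s - 1) ∧
        (scalarInvertibles (ZMod (2 ^ s)) (CayleyInt₂ (2 ^ s) α β)).ncard = 2 ^ (s - 1) ∧
        (scalarInvertibles (ZMod (2 ^ s)) (CayleyInt₃ (2 ^ s) α β γ)).ncard = 2 ^ (s - 1) ∧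
        (invertibles (ZMod (2 ^ s))).ncard = 2 ^ (s - 1) ∧
        (invertibles (CayleyInt₁ (2 ^ s) α)).ncard = 2 ^ (2 * s - 1) ∧
        (invertibles (CayleyInt₂ (2 ^ s) α β)).ncard = 2 ^ (4 * s - 1) ∧
        (invertibles (CayleyInt₃ (2 ^ s) α β γ)).ncard = 2 ^ (8 * s - 1) ∧
        (s = 1 → (unimodulars (ZMod (2 ^ s)) (ZMod (2 ^ s))).ncard = 1) ∧
        (s = 2 → (unimodulars (ZMod (2 ^ s)) (ZMod (2 ^ s))).ncard = 2) ∧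
        (3 ≤ s → (unimodulars (ZMod (2 ^ s)) (ZMod (2 ^ s))).ncard = 4) ∧
        (s = 1 → (unimodulars (ZMod (2 ^ s)) (CayleyInt₁ (2 ^ s) α)).ncard = 2) ∧
        (2 ≤ s → (unimodulars (ZMod (2 ^ s)) (CayleyInt₁ (2 ^ s) α)).ncard =
          2 ^ (s + 1 - residueDigit 2 α 1)) ∧
        (unimodulars (ZMod (2 ^ s)) (CayleyInt₂ (2 ^ s) α β)).ncard = 2 ^ (3 * s) ∧
        (unimodulars (ZMod (2 ^ s)) (CayleyInt₃ (2 ^ s) α β γ)).ncard = 2 ^ (7 * s)) := by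
  exact ⟨fun k m _ hm α β γ => multiplicativity k m hm α β γ,
    fun p _ hp s hs α β γ hα hβ hγ => odd_prime_powers p hp s hs α β γ hα hβ hγ,
    fun s hs α β γ hα hβ hγ => powers_of_two s hs α β γ hα hβ hγ⟩
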